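/- Let $k$ be a field and let $X$ be a bornological coarse space: a set with a bornology (a family of bounded subsets which contains all finite subsets and is closed under subsets and finite unions) and a coarse structure (a family of entourages $U\subseteq X\times X$ which contains the diagonal and is closed under subsets, finite unions, inverses and compositions), such that every thickening $U[B]=\{x : \exists\, b\in B,\ (x,b)\in U\}$ of a bounded set $B$ by an entourage $U$ is bounded. *Controlled vector spaces.* An $X$-controlled finite-dimensional $k$-vector space is a functor $M$ from the poset $\mathcal B(X)$ of bounded subsets to finite-dimensional $k$-vector spaces such that $M(\emptyset)=0$, such that for all bounded $B,B'$ the square formed by $M(B\cap B')$, $M(B)$, $M(B')$, $M(B\cup B')$ is a push-out, and such that every bounded $B$ contains a finite subset $F$ for which $M(F)\to M(B)$ is an isomorphism. Morphisms $M\to M'$ are elements of $\operatorname{colim}_U \mathrm{Nat}(M, M'\circ U[-])$, the colimit over all entourages $U$. This gives a $k$-linear category $V_k(X)$. Write $M(x)=M(\{x\})$; a morphism $A\colon M\to M'$ induces linear maps $A^{x,y}\colon M(x)\to M'(U[x])\cong\bigoplus_{z\in U[x]}M'(z)\to M'(y)$ for $x,y\in X$ (zero if $y\notin U[x]$). *Coarse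 Hochschild homology.* Let $$\mathrm{CN}_n(V_k(X))=\bigoplus_{(C_0,\dots,C_n)}\operatorname{Hom}(C_1,C_0)\otimes_k\operatorname{Hom}(C_2,C_1)\otimes_k\cdots\otimes_k\operatorname{Hom}(C_0,C_n)$$ be the additive cyclic nerve, where the sum runs over all $(n+1)$-tuples of objects of $V_k(X)$, with $b=\sum_{i=0}^n(-1)^id_i$, where $d_i(f_0\otimes\cdots\otimes f_n)=f_0\otimes\cdots\otimes f_i\circ f_{i+1}\otimes\cdots\otimes f_n$ for $i<n$ and $d_n(f_0\otimes\cdots\otimes f_n)=f_n\circ f_0\otimes f_1\otimes\cdots\otimes f_{n-1}$. The chain complex $(\mathrm{CN}_*(V_k(X)),b)$ represents the coarse Hochschild homology $\mathcal X\mathrm{HH}_k(X)$ in the $\infty$-category $\mathbf{Ch}_\infty$ of chain complexes (the localization of chain complexes at the quasi-isomorphisms). *Coarse ordinary homology.* Let $\mathcal XC_n(X)$ be the $k$-vector space of functions $c\colon X^{n+1}\to k$ (written $\sum_x c(x)\,x$) that are locally finite (for each bounded $B$ only finitely many tuples in the support have an entry in $B$) and controlled (there is an entourage $U$ such that $(x_i,x_j)\in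 U$ for all $i,j$ and all $(x_0,\dots,x_n)$ in the support), with $\partial=\sum_i(-1)^i\partial_i$, where $\partial_i$ omits the entry $x_i$. The chain complex $(\mathcal XC_*(X),\partial)$ represents the coarse ordinary homology $\mathcal X\mathrm H(X)$ (with coefficients in $k$) in $\mathbf{Ch}_\infty$. *The transformation.* For $A_i\colon M_{i+1}\to M_i$ (with $M_{n+1}=M_0$) put $$\phi_n(A_0\otimes\cdots\otimes A_n)=\sum_{(x_0,\dots,x_n)\in X^{n+1}}\operatorname{tr}\Bigl(M_0(x_n)\xrightarrow{A_n^{x_n,x_{n-1}}}M_n(x_{n-1})\to\cdots\to M_1(x_0)\xrightarrow{A_0^{x_0,x_n}}M_0(x_n)\Bigr)\cdot(x_0,\dots,x_n).$$ These maps form a chain map $\phi\colon(\mathrm{CN}_*(V_k(X)),b)\to(\mathcal XC_*(X),\partial)$, which represents the transformation $\Phi_{\mathcal X\mathrm{HH}_k}\colon\mathcal X\mathrm{HH}_k(X)\to\mathcal X\mathrm H(X)$. **Proposition 4.8.** If $X=\{*\}$ is the one-point space, then $\Phi_{\mathcal X\mathrm{HH}_k}\colon\mathcal X\mathrm{HH}_k(*)\to\mathcal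 X\mathrm H(*)$ is an equivalence of chain complexes, that is, $\phi\colon(\mathrm{CN}_*(V_k(*)),b)\to(\mathcal XC_*(*),\partial)$ is a quasi-isomorphism. -/

import Mathlib

open CategoryTheory CategoryTheory.Limits

universe u

noncomputable section

namespace CoarseHH

/-- A bornological coarse space: a set with a bornology (Mathlib's `Bornology`) and a compatible
coarse structure. -/
class BornCoarse (X : Type u) extends Bornology X where
  /-- The entourages. -/
  IsEntourage : Set (X × X) → Prop
  diag : IsEntourage {p | p.1 = p.2}
  subset : ∀ {U V}, V ⊆ U → IsEntourage U → IsEntourage V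
  union : ∀ {U V}, IsEntourage U → IsEntourage V → IsEntourage (U ∪ V)
  inv : ∀ {U}, IsEntourage U → IsEntourage {p | (p.2, p.1) ∈ U}
  comp : ∀ {U V}, IsEntourage U → IsEntourage V →
    IsEntourage {p | ∃ y, (p.1, y) ∈ U ∧ (y, p.2) ∈ V}
  thickening : ∀ {U : Set (X × X)} {B : Set X}, IsEntourage U →
    Bornology.IsBounded B → Bornology.IsBounded {x | ∃ b ∈ B, (x, b) ∈ U}

section Space

variable (X : Type u) [BornCoarse X]

/-- The poset of bounded subsets, viewed as a category. -/
abbrev Bdd := {B : Set X // Bornology.IsBounded B}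

/-- The poset of entourages. -/
abbrev Ent := {U : Set (X × X) // BornCoarse.IsEntourage U}

variable {X}

instance : IsDirectedOrder (Ent X) :=
  ⟨fun U V => ⟨⟨U.1 ∪ V.1, BornCoarse.union U.2 V.2⟩,
    Set.subset_union_left, Set.subset_union_right⟩⟩

instance : Nonempty (Ent X) := ⟨⟨_, BornCoarse.diag⟩⟩

namespace Ent

/-- The diagonal. -/
def diag : Ent X := ⟨_, BornCoarse.diag⟩

/-- The composition `U ∘ V` of entourages. -/
def comp (U V : Ent X) : Ent X := ⟨_, BornCoarse.comp U.2 V.2⟩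

lemma comp_mono {U U' V V' : Ent X} (h : U ≤ U') (h' : V ≤ V') : U.comp V ≤ U'.comp V' :=
  fun _ ⟨y, hy, hy'⟩ => ⟨y, h hy, h' hy'⟩

lemma le_comp_diag (U : Ent X) : U ≤ U.comp diag := fun p hp => ⟨p.2, hp, rfl⟩

lemma le_diag_comp (U : Ent X) : U ≤ diag.comp U := fun p hp => ⟨p.1, rfl, hp⟩

lemma comp_comp_le (U V W : Ent X) : (U.comp V).comp W ≤ U.comp (V.comp W) :=
  fun _ ⟨y, ⟨z, hz, hz'⟩, hy⟩ => ⟨z, hz, y, hz', hy⟩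

/-- The thickening `U[B]`. -/
def thick (U : Ent X) (B : Bdd X) : Bdd X := ⟨_, BornCoarse.thickening U.2 B.2⟩

lemma thick_mono {U V : Ent X} {B B' : Bdd X} (h : U ≤ V) (hB : B ≤ B') :
    U.thick B ≤ V.thick B' :=
  fun _ ⟨b, hb, hx⟩ => ⟨b, hB hb, h hx⟩

lemma thick_thick (U V : Ent X) (B : Bdd X) : V.thick (U.thick B) ≤ (V.comp U).thick B :=
  fun _ ⟨y, ⟨b, hb, hy⟩, hx⟩ => ⟨b, hb, y, hx, hy⟩

lemma le_thick_diag (B : Bdd X) : B ≤ diag.thick B := fun x hx => ⟨x, hx, rfl⟩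

/-- The functor `U[-]` on bounded subsets. -/
abbrev thickFunctor (U : Ent X) : Bdd X ⥤ Bdd X where
  obj := U.thick
  map f := homOfLE (thick_mono le_rfl (leOfHom f))

/-- The natural transformation `U[-] ⟶ V[-]` for `U ⊆ V`. -/
abbrev thickTrans {U V : Ent X} (h : U ≤ V) : U.thickFunctor ⟶ V.thickFunctor where
  app B := homOfLE (thick_mono h le_rfl)

end Ent

namespace Bdd

instance : Union (Bdd X) := ⟨fun B C => ⟨B.1 ∪ C.1, B.2.union C.2⟩⟩

instance : Inter (Bdd X) := ⟨fun B C => ⟨B.1 ∩ C.1, B.2.subset Set.inter_subset_left⟩⟩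

instance : EmptyCollection (Bdd X) := ⟨⟨∅, Bornology.isBounded_empty⟩⟩

/-- The bounded set `{x}`. -/
def pt (x : X) : Bdd X := ⟨{x}, Bornology.isBounded_singleton⟩

/-- The bounded set `B \ {x}`. -/
def erase (B : Bdd X) (x : X) : Bdd X := ⟨B.1 \ {x}, B.2.subset Set.sdiff_subset⟩

lemma le_union_left (B C : Bdd X) : B ≤ B ∪ C := Set.subset_union_left (s := B.1) (t := C.1)
lemma le_union_right (B C : Bdd X) : C ≤ B ∪ C := Set.subset_union_right (s := B.1) (t := C.1)
lemma inter_le_left (B C : Bdd X) : B ∩ C ≤ B := Set.inter_subset_left (s := B.1) (t := C.1)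
lemma inter_le_right (B C : Bdd X) : B ∩ C ≤ C := Set.inter_subset_right (s := B.1) (t := C.1)

lemma le_pt_union_erase (B : Bdd X) (x : X) : B ≤ pt x ∪ B.erase x := fun y hy => by
  by_cases h : y = x
  · exact Or.inl h
  · exact Or.inr ⟨hy, h⟩

lemma pt_inter_erase (B : Bdd X) (x : X) : pt x ∩ B.erase x = ∅ := by
  apply Subtype.ext
  change ({x} ∩ (B.1 \ {x}) : Set X) = ∅
  simp

end Bdd

end Space

variable (k : Type u) [Field k] (X : Type u) [BornCoarse X]

/-- An `X`-controlled finite-dimensional `k`-vector space. -/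
structure ControlledObject where
  /-- The underlying functor from bounded subsets to finite-dimensional vector spaces. -/
  M : Bdd X ⥤ FGModuleCat.{u} k
  isZero_empty : IsZero (M.obj ∅)
  isPushout : ∀ B C : Bdd X,
    IsPushout (M.map (homOfLE (B.inter_le_left C))) (M.map (homOfLE (B.inter_le_right C)))
      (M.map (homOfLE (B.le_union_left C))) (M.map (homOfLE (B.le_union_right C)))
  finite_support : ∀ B : Bdd X, ∃ (F : Bdd X) (h : F ≤ B), F.1.Finite ∧ IsIso (M.map (homOfLE h))

variable {k X}

namespace ControlledObject

/-- The map `M(B) ⟶ M(C)` for bounded subsets `B ⊆ C`. -/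
def incl (M : ControlledObject k X) {B C : Bdd X} (h : B ≤ C) : M.M.obj B ⟶ M.M.obj C :=
  M.M.map (homOfLE h)

@[simp] lemma incl_self (M : ControlledObject k X) {B : Bdd X} (h : B ≤ B) : M.incl h = 𝟙 _ :=
  M.M.map_id B

@[simp] lemma incl_incl (M : ControlledObject k X) {B C D : Bdd X} (h : B ≤ C) (h' : C ≤ D) :
    M.incl h ≫ M.incl h' = M.incl (h.trans h') := (M.M.map_comp _ _).symm

@[simp] lemma incl_incl_assoc (M : ControlledObject k X) {B C D : Bdd X} (h : B ≤ C) (h' : C ≤ D)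
    {Z : FGModuleCat.{u} k} (g : M.M.obj D ⟶ Z) :
    M.incl h ≫ M.incl h' ≫ g = M.incl (h.trans h') ≫ g := by
  rw [← Category.assoc, incl_incl]

/-- The `k`-vector space of `U`-controlled morphisms: natural transformations
`M ⟶ N ∘ U[-]`. -/
abbrev Mor (M N : ControlledObject k X) (U : Ent X) := M.M ⟶ U.thickFunctor ⋙ N.M

/-- The component `M(B) ⟶ N(U[B])`. -/
def Mor.at {M N : ControlledObject k X} {U : Ent X} (a : Mor M N U) (B : Bdd X) :
    M.M.obj B ⟶ N.M.obj (U.thick B) := a.app B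

lemma Mor.incl_at {M N : ControlledObject k X} {U : Ent X} (a : Mor M N U) {B C : Bdd X}
    (h : B ≤ C) : M.incl h ≫ a.at C = a.at B ≫ N.incl (Ent.thick_mono le_rfl h) :=
  a.naturality (homOfLE h)

lemma Mor.ext {M N : ControlledObject k X} {U : Ent X} {a b : Mor M N U}
    (h : ∀ B, a.at B = b.at B) : a = b := NatTrans.ext (funext h)

/-- Enlarging the entourage. -/
def morTrans (M N : ControlledObject k X) (U V : Ent X) (h : U ≤ V) :
    Mor M N U →ₗ[k] Mor M N V :=
  Linear.rightComp k M.M (Functor.whiskerRight (Ent.thickTrans h) N.M)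

lemma morTrans_at (M N : ControlledObject k X) (U V : Ent X) (h : U ≤ V)
    (a : Mor M N U) (B : Bdd X) :
    (morTrans M N U V h a).at B = a.at B ≫ N.incl (Ent.thick_mono h le_rfl) := rfl

instance (M N : ControlledObject k X) :
    DirectedSystem (Mor M N) (fun U V h => (morTrans M N U V h : Mor M N U → Mor M N V)) where
  map_self U a := Mor.ext fun B => by simp [morTrans_at]
  map_map U V W h h' a := Mor.ext fun B => by simp [morTrans_at]

/-- Controlled morphisms: the colimit over all entourages `U` of the `U`-controlled morphisms. -/
abbrev Hom (M N : ControlledObject k X) := DirectLimit (Mor M N) (morTrans M N)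

/-- The morphism represented by a `U`-controlled one. -/
def Hom.of {M N : ControlledObject k X} (U : Ent X) : Mor M N U →ₗ[k] Hom M N :=
  DirectLimit.Module.of k (Ent X) (Mor M N) (morTrans M N) U

lemma Hom.of_trans {M N : ControlledObject k X} {U V : Ent X} (h : U ≤ V) (a : Mor M N U) :
    Hom.of V (morTrans M N U V h a) = Hom.of U a :=
  DirectLimit.Module.of_f

lemma Hom.exists_of {M N : ControlledObject k X} (f : Hom M N) : ∃ U a, f = Hom.of U a :=
  DirectLimit.exists_eq_mk (morTrans M N) f

/-- Two representatives agree in the colimit when their components agree after enlarging to a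
common entourage. -/
lemma Hom.of_eq_of {M N : ControlledObject k X} {U V : Ent X} (W : Ent X) (hU : U ≤ W) (hV : V ≤ W)
    {a : Mor M N U} {b : Mor M N V}
    (h : ∀ B, a.at B ≫ N.incl (Ent.thick_mono hU le_rfl) =
      b.at B ≫ N.incl (Ent.thick_mono hV le_rfl)) : Hom.of U a = Hom.of V b := by
  rw [← Hom.of_trans hU, ← Hom.of_trans hV]
  exact congrArg _ (Mor.ext h)

/-- The identity, as a diagonal-controlled morphism. -/
def morId (M : ControlledObject k X) : Mor M M Ent.diag where
  app B := M.incl (Ent.le_thick_diag B)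
  naturality B C f := by
    change M.incl (leOfHom f) ≫ M.incl _ = M.incl _ ≫ M.incl _
    simp

/-- The composition of a `U`-controlled and a `V`-controlled morphism, which is
`V ∘ U`-controlled. -/
def morComp {M N P : ControlledObject k X} {U V : Ent X} :
    Mor M N U →ₗ[k] Mor N P V →ₗ[k] Mor M P (V.comp U) :=
  LinearMap.mk₂ k (fun a b =>
      { app := fun B => a.at B ≫ b.at (U.thick B) ≫ P.incl (Ent.thick_thick U V B)
        naturality := fun B C f => by
          change M.incl (leOfHom f) ≫ a.at C ≫ b.at _ ≫ P.incl _ =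
            (a.at B ≫ b.at _ ≫ P.incl _) ≫ P.incl _
          rw [← Category.assoc, a.incl_at, Category.assoc, ← Category.assoc (N.incl _),
            b.incl_at]
          simp })
    (fun a a' b => Mor.ext fun B => Preadditive.add_comp _ _ _ _ _ _)
    (fun c a b => Mor.ext fun B => Linear.smul_comp _ _ _ _ _ _)
    (fun a b b' => Mor.ext fun B => by
      change a.at B ≫ (b.at _ + b'.at _) ≫ _ = a.at B ≫ b.at _ ≫ _ + a.at B ≫ b'.at _ ≫ _
      rw [Preadditive.add_comp, Preadditive.comp_add])
    (fun c a b => Mor.ext fun B => by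
      change a.at B ≫ (c • b.at _) ≫ _ = c • (a.at B ≫ b.at _ ≫ _)
      rw [Linear.smul_comp, Linear.comp_smul])

lemma morComp_at {M N P : ControlledObject k X} {U V : Ent X} (a : Mor M N U) (b : Mor N P V)
    (B : Bdd X) : (morComp a b).at B =
      a.at B ≫ b.at (U.thick B) ≫ P.incl (Ent.thick_thick U V B) := rfl

/-- Composition of controlled morphisms, as a bilinear map. -/
def Hom.compₗ {M N P : ControlledObject k X} : Hom M N →ₗ[k] Hom N P →ₗ[k] Hom M P :=
  DirectLimit.Module.lift k (Ent X) (Mor M N) (morTrans M N)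
    (fun U => (DirectLimit.Module.lift k (Ent X) (Mor N P) (morTrans N P)
      (fun V => LinearMap.compr₂ morComp (Hom.of (V.comp U)) |>.flip)
      (fun V V' h b => LinearMap.ext fun a => (Hom.of_eq_of (V'.comp U) le_rfl
        (Ent.comp_mono h le_rfl) fun B => by simp [morComp_at, morTrans_at]))).flip)
    (fun U U' h a => LinearMap.ext fun g => by
      obtain ⟨V, b, rfl⟩ := g.exists_of
      refine Hom.of_eq_of (V.comp U') le_rfl (Ent.comp_mono le_rfl h) fun B => ?_
      simp only [morComp_at, morTrans_at, Category.assoc, incl_incl]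
      rw [← Category.assoc (N.incl _), b.incl_at]
      simp)

lemma Hom.comp_of {M N P : ControlledObject k X} {U V : Ent X} (a : Mor M N U) (b : Mor N P V) :
    Hom.compₗ (Hom.of U a) (Hom.of V b) = Hom.of (V.comp U) (morComp a b) := rfl

/-- The category of `X`-controlled finite-dimensional `k`-vector spaces. -/
instance : Category (ControlledObject k X) where
  Hom := Hom
  id M := Hom.of Ent.diag M.morId
  comp f g := Hom.compₗ f g
  id_comp {M N} f := by
    obtain ⟨U, a, rfl⟩ := f.exists_of
    refine (Hom.comp_of _ _).trans (Hom.of_eq_of (U.comp Ent.diag) le_rfl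
      U.le_comp_diag fun B => ?_)
    have h : M.morId.at B = M.incl (Ent.le_thick_diag B) := rfl
    rw [morComp_at, h, ← Category.assoc, a.incl_at]
    simp
  comp_id {M N} f := by
    obtain ⟨U, a, rfl⟩ := f.exists_of
    refine (Hom.comp_of _ _).trans (Hom.of_eq_of (Ent.diag.comp U) le_rfl
      U.le_diag_comp fun B => ?_)
    have h : ∀ B, N.morId.at B = N.incl (Ent.le_thick_diag B) := fun _ => rfl
    rw [morComp_at, h]
    simp
  assoc {M N P Q} f g h := by
    obtain ⟨U, a, rfl⟩ := f.exists_of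
    obtain ⟨V, b, rfl⟩ := g.exists_of
    obtain ⟨W, c, rfl⟩ := h.exists_of
    rw [Hom.comp_of, Hom.comp_of, Hom.comp_of, Hom.comp_of]
    refine Hom.of_eq_of (W.comp (V.comp U)) le_rfl
      (Ent.comp_comp_le _ _ _) fun B => ?_
    simp only [morComp_at, Category.assoc, incl_incl]
    rw [← Category.assoc (P.incl _), c.incl_at]
    simp

instance : Preadditive (ControlledObject k X) where
  homGroup M N := inferInstanceAs (AddCommGroup (Hom M N))
  add_comp _ _ _ f f' g := congrArg (fun l => l g) (Hom.compₗ.map_add f f')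
  comp_add _ _ _ f g g' := (Hom.compₗ f).map_add g g'

instance : Linear k (ControlledObject k X) where
  homModule M N := inferInstanceAs (Module k (Hom M N))
  smul_comp _ _ _ c f g := congrArg (fun l => l g) (Hom.compₗ.map_smul c f)
  comp_smul _ _ _ f c g := (Hom.compₗ f).map_smul c g

/-- The projection `M(B) ⟶ M(x)` onto the value at a point, killing `M(B \ {x})`. -/
noncomputable def proj (M : ControlledObject k X) (B : Bdd X) (x : X) :
    M.M.obj B ⟶ M.M.obj (Bdd.pt x) :=
  M.incl (B.le_pt_union_erase x) ≫ (M.isPushout (Bdd.pt x) (B.erase x)).desc (𝟙 _) 0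
    (IsZero.eq_of_src (by rw [Bdd.pt_inter_erase]; exact M.isZero_empty) _ _)

end ControlledObject

section CyclicNerve

/-- The cyclic predecessor on `{0, …, n}`: it sends `i + 1` to `i` and `0` to `n`. -/
def cpred {n : ℕ} (i : Fin (n + 1)) : Fin (n + 1) := Fin.cases (Fin.last n) Fin.castSucc i

variable {V : Type*} [Category V]

/-- A cyclic string of morphisms: `f i : N i ⟶ N (i - 1)`, with indices read cyclically in
`{0, …, n}`. With `N i = C (i + 1)` these are the tuples `(f 0, …, f n)`,
`f i : C (i + 1) ⟶ C i`. -/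
abbrev CyclicString {n : ℕ} (N : Fin (n + 1) → V) := ∀ i, N i ⟶ N (cpred i)

namespace CyclicString

variable {n m l : ℕ} {N : Fin (n + 1) → V}

/-- The entry `f (i + 1) : N (i + 1) ⟶ N i`. -/
def step (f : CyclicString N) (i : Fin n) : N i.succ ⟶ N i.castSucc := f i.succ

/-- The closing entry `f 0 : N 0 ⟶ N n`. -/
def close (f : CyclicString N) : N 0 ⟶ N (Fin.last n) := f 0

/-- A cyclic string is given by its closing entry and the others. -/
def ofClose (c : N 0 ⟶ N (Fin.last n)) (s : ∀ i : Fin n, N i.succ ⟶ N i.castSucc) :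
    CyclicString N := Fin.cases c s

@[simp] lemma close_ofClose (c : N 0 ⟶ N (Fin.last n))
    (s : ∀ i : Fin n, N i.succ ⟶ N i.castSucc) : (ofClose c s).close = c := rfl

@[simp] lemma step_ofClose (c : N 0 ⟶ N (Fin.last n))
    (s : ∀ i : Fin n, N i.succ ⟶ N i.castSucc) (i : Fin n) : (ofClose c s).step i = s i := rfl

lemma ext' {f g : CyclicString N} (h : f.close = g.close) (h' : ∀ i, f.step i = g.step i) :
    f = g := funext (Fin.cases h h')

/-- The composite `f (i + 1) ∘ ⋯ ∘ f j : N j ⟶ N i` for `i ≤ j` (the identity for `i = j`). -/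
def down (f : CyclicString N) {i j : Fin (n + 1)} (h : i ≤ j) : N j ⟶ N i :=
  ((ComposableArrows.mkOfObjOfMapSucc (fun i => Opposite.op (N i))
    (fun i => (f.step i).op)).map (homOfLE h)).unop

@[simp] lemma down_self (f : CyclicString N) {i : Fin (n + 1)} (h : i ≤ i) : f.down h = 𝟙 _ :=
  congrArg Quiver.Hom.unop (CategoryTheory.Functor.map_id _ i)

@[simp] lemma down_down (f : CyclicString N) {a b c : Fin (n + 1)} (h : a ≤ b) (h' : b ≤ c) :
    f.down h' ≫ f.down h = f.down (h.trans h') :=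
  (congrArg Quiver.Hom.unop (CategoryTheory.Functor.map_comp _ (homOfLE h) (homOfLE h'))).symm

@[simp] lemma down_down_assoc (f : CyclicString N) {a b c : Fin (n + 1)} (h : a ≤ b) (h' : b ≤ c)
    {Z : V} (g : N a ⟶ Z) : f.down h' ≫ f.down h ≫ g = f.down (h.trans h') ≫ g := by
  rw [← Category.assoc, down_down]

lemma down_step (f : CyclicString N) (i : Fin n) (h : i.castSucc ≤ i.succ) :
    f.down h = f.step i :=
  congrArg Quiver.Hom.unop (ComposableArrows.mkOfObjOfMapSucc_map_succ
    (fun i => Opposite.op (N i)) (fun i => (f.step i).op) i.1 i.2)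

lemma down_succ (f : CyclicString N) {i : Fin (n + 1)} {j : Fin n} (h : i ≤ j.castSucc)
    (h' : i ≤ j.succ) : f.down h' = f.step j ≫ f.down h := by
  rw [← f.down_step j (Fin.castSucc_le_succ j), down_down]

lemma down_congr {f g : CyclicString N} {i j : Fin (n + 1)} (h : i ≤ j)
    (hfg : ∀ a : Fin n, i < a.succ → a.succ ≤ j → f.step a = g.step a) :
    f.down h = g.down h := by
  induction j using Fin.induction with
  | zero => obtain rfl : i = 0 := le_antisymm h (Fin.zero_le _); simp
  | succ j ih =>
    rcases h.eq_or_lt with rfl | hlt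
    · simp
    · have h' : i ≤ j.castSucc := Fin.le_castSucc_iff.2 hlt
      rw [down_succ f h', down_succ g h', hfg j hlt le_rfl,
        ih h' fun a ha ha' => hfg a ha (ha'.trans (Fin.castSucc_le_succ j))]

lemma mono (α : Fin (m + 1) →o Fin (n + 1)) {i j : Fin (m + 1)} (h : i ≤ j) : α i ≤ α j :=
  α.monotone h

/-- The action of a monotone map `α : {0, …, m} → {0, …, n}` on cyclic strings: the objects are
`N ∘ α` and consecutive morphisms are composed along the gaps of `α`, those before `α 0` and after
`α m` being composed cyclically through `f 0`. For the injection omitting `i` this composes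
`f i` with `f (i + 1)` (and `f n` with `f 0` when `i = n`); for the surjection repeating `i` it
inserts the identity of `N i = C (i + 1)` after `f i`. -/
def pull (f : CyclicString N) (α : Fin (m + 1) →o Fin (n + 1)) :
    CyclicString (fun j => N (α j)) :=
  ofClose (f.down (Fin.zero_le (α 0)) ≫ f.close ≫ f.down (Fin.le_last (α (Fin.last m))))
    (fun j => f.down (mono α (Fin.castSucc_le_succ j)))

lemma close_pull (f : CyclicString N) (α : Fin (m + 1) →o Fin (n + 1)) :
    (f.pull α).close =
      f.down (Fin.zero_le (α 0)) ≫ f.close ≫ f.down (Fin.le_last (α (Fin.last m))) := rfl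

lemma step_pull (f : CyclicString N) (α : Fin (m + 1) →o Fin (n + 1)) (j : Fin m) :
    (f.pull α).step j = f.down (mono α (Fin.castSucc_le_succ j)) := rfl

lemma down_pull (f : CyclicString N) (α : Fin (m + 1) →o Fin (n + 1)) {i j : Fin (m + 1)}
    (h : i ≤ j) : (f.pull α).down h = f.down (mono α h) := by
  induction j using Fin.induction with
  | zero => obtain rfl : i = 0 := le_antisymm h (Fin.zero_le _); simp
  | succ j ih =>
    rcases h.eq_or_lt with rfl | hlt
    · simp
    · have h' : i ≤ j.castSucc := Fin.le_castSucc_iff.2 hlt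
      rw [down_succ _ h', step_pull, ih h', down_down]

lemma pull_id (f : CyclicString N) : f.pull OrderHom.id = f := by
  refine ext' ?_ fun j => ?_
  · rw [close_pull]
    have h1 : f.down (Fin.zero_le ((OrderHom.id : Fin (n + 1) →o Fin (n + 1)) 0)) = 𝟙 (N 0) :=
      f.down_self _
    have h2 : f.down (Fin.le_last ((OrderHom.id : Fin (n + 1) →o Fin (n + 1)) (Fin.last n))) =
      𝟙 (N (Fin.last n)) := f.down_self _
    rw [h1, h2]
    exact (Category.id_comp _).trans (Category.comp_id _)
  · exact f.down_step j _

lemma pull_comp (f : CyclicString N) (α : Fin (m + 1) →o Fin (n + 1))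
    (β : Fin (l + 1) →o Fin (m + 1)) : f.pull (α.comp β) = (f.pull α).pull β := by
  have h : ((f.pull α).pull β).close = f.down (Fin.zero_le (α (β 0))) ≫ f.close ≫
      f.down (Fin.le_last (α (β (Fin.last l)))) := by
    rw [close_pull, close_pull, down_pull, down_pull]
    simp only [Category.assoc]
    rw [down_down_assoc, down_down]
  exact ext' h.symm fun j => (f.down_pull α _).symm

lemma down_eq_of_agree {f g : CyclicString N} {a : Fin (n + 1)}
    (hg : ∀ b, b ≠ a → g b = f b) {i j : Fin (n + 1)} (h : i ≤ j) (ha : a ≤ i ∨ j < a) :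
    g.down h = f.down h :=
  down_congr h fun b hb hb' => hg _ (by
    rintro rfl
    rcases ha with ha | ha
    · exact absurd hb ha.not_gt
    · exact absurd hb' ha.not_ge)

lemma down_eq_of_agree_succ {f g : CyclicString N} {a : Fin n}
    (hg : ∀ b, b ≠ a.succ → g b = f b) {i j : Fin (n + 1)} (h : i ≤ j) (hi : i ≤ a.castSucc)
    (hj : a.succ ≤ j) : g.down h = f.down hj ≫ g.step a ≫ f.down hi := by
  rw [← down_down g (hi.trans (Fin.castSucc_le_succ a)) hj, down_succ g hi,
    down_eq_of_agree hg hj (Or.inl le_rfl),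
    down_eq_of_agree hg hi (Or.inr Fin.castSucc_lt_succ)]

lemma close_eq_of_agree {f g : CyclicString N} {a : Fin n}
    (hg : ∀ b, b ≠ a.succ → g b = f b) : g.close = f.close :=
  hg 0 (Fin.succ_ne_zero a).symm

/-- A single entry of a cyclic string enters linearly into exactly one entry of `f.pull α`. -/
lemma exists_pull_of_agree (k : Type*) [Field k] [Preadditive V] [Linear k V]
    (f : CyclicString N) (α : Fin (m + 1) →o Fin (n + 1)) (a : Fin (n + 1)) :
    ∃ (j : Fin (m + 1)) (L : (N a ⟶ N (cpred a)) →ₗ[k] (N (α j) ⟶ N (α (cpred j)))),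
      ∀ g : CyclicString N, (∀ b, b ≠ a → g b = f b) →
        (g.pull α) j = L (g a) ∧ ∀ i, i ≠ j → (g.pull α) i = (f.pull α) i := by
  revert a
  refine Fin.cases ?_ fun a => ?_
  · refine ⟨0, Linear.leftComp k (N (α (Fin.last m))) (f.down (Fin.zero_le (α 0))) ∘ₗ
      Linear.rightComp k (N 0) (f.down (Fin.le_last (α (Fin.last m)))), fun g hg => ⟨?_, ?_⟩⟩
    · change (g.pull α).close = f.down _ ≫ g.close ≫ f.down _
      rw [close_pull, down_eq_of_agree hg _ (Or.inl (Fin.zero_le _)),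
        down_eq_of_agree hg _ (Or.inl (Fin.zero_le _))]
    · refine Fin.cases (fun h => absurd rfl h) fun i _ => ?_
      exact down_eq_of_agree hg _ (Or.inl (Fin.zero_le _))
  by_cases h0 : a.succ ≤ α 0
  · refine ⟨0, Linear.leftComp k (N (α (Fin.last m))) (f.down h0) ∘ₗ Linear.rightComp k (N a.succ)
      (f.down (Fin.zero_le a.castSucc) ≫ f.close ≫ f.down (Fin.le_last (α (Fin.last m)))),
      fun g hg => ⟨?_, ?_⟩⟩
    · change (g.pull α).close = f.down _ ≫ g.step a ≫ f.down _ ≫ f.close ≫ f.down _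
      rw [close_pull, close_eq_of_agree hg, down_eq_of_agree_succ hg _ (Fin.zero_le _) h0,
        down_eq_of_agree hg _ (Or.inl (h0.trans (mono α (Fin.zero_le _))))]
      simp only [Category.assoc]
    · refine Fin.cases (fun h => absurd rfl h) fun i _ => ?_
      exact down_eq_of_agree hg _ (Or.inl (h0.trans (mono α (Fin.zero_le _))))
  by_cases h1 : α (Fin.last m) < a.succ
  · refine ⟨0, Linear.leftComp k (N (α (Fin.last m))) (f.down (Fin.zero_le (α 0)) ≫ f.close ≫
      f.down (Fin.le_last a.succ)) ∘ₗ
        Linear.rightComp k (N a.succ) (f.down (Fin.le_castSucc_iff.2 h1)),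
      fun g hg => ⟨?_, ?_⟩⟩
    · change (g.pull α).close = (f.down _ ≫ f.close ≫ f.down _) ≫ g.step a ≫ f.down _
      rw [close_pull, close_eq_of_agree hg, down_eq_of_agree hg _ (Or.inr (not_le.1 h0)),
        down_eq_of_agree_succ hg _ (Fin.le_castSucc_iff.2 h1) (Fin.le_last _)]
      simp only [Category.assoc]
    · refine Fin.cases (fun h => absurd rfl h) fun i _ => ?_
      exact down_eq_of_agree hg _ (Or.inr ((mono α (Fin.le_last _)).trans_lt h1))
  obtain ⟨b, hb, hb'⟩ : ∃ b : Fin m, α b.castSucc < a.succ ∧ a.succ ≤ α b.succ := by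
    by_contra hcon
    push Not at hcon
    have : ∀ c : Fin (m + 1), α c < a.succ := fun c => by
      induction c using Fin.induction with
      | zero => exact not_le.1 h0
      | succ c ih => exact hcon c ih
    exact h1 (this _)
  refine ⟨b.succ, Linear.leftComp k (N (α b.castSucc)) (f.down hb') ∘ₗ
    Linear.rightComp k (N a.succ) (f.down (Fin.le_castSucc_iff.2 hb)), fun g hg => ⟨?_, ?_⟩⟩
  · exact down_eq_of_agree_succ hg _ (Fin.le_castSucc_iff.2 hb) hb'
  refine Fin.cases (fun _ => ?_) fun i hi => ?_
  · change (g.pull α).close = (f.pull α).close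
    rw [close_pull, close_pull, close_eq_of_agree hg,
      down_eq_of_agree hg _ (Or.inr (not_le.1 h0)), down_eq_of_agree hg _ (Or.inl (not_lt.1 h1))]
  · refine down_eq_of_agree hg _ ?_
    rcases lt_trichotomy i b with h | rfl | h
    · exact Or.inr ((mono α (Fin.succ_le_castSucc_iff.2 h)).trans_lt hb)
    · exact absurd rfl hi
    · exact Or.inl (hb'.trans (mono α (Fin.succ_le_castSucc_iff.2 h)))

lemma exists_pull_update (k : Type*) [Field k] [Preadditive V] [Linear k V]
    [DecidableEq (Fin (n + 1))] [DecidableEq (Fin (m + 1))] (f : CyclicString N)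
    (α : Fin (m + 1) →o Fin (n + 1)) (a : Fin (n + 1)) :
    ∃ (j : Fin (m + 1)) (L : (N a ⟶ N (cpred a)) →ₗ[k] (N (α j) ⟶ N (α (cpred j)))),
      ∀ v, pull (Function.update f a v) α = Function.update (f.pull α) j (L v) := by
  obtain ⟨j, L, h⟩ := exists_pull_of_agree k f α a
  refine ⟨j, L, fun v => ?_⟩
  obtain ⟨h1, h2⟩ := h (Function.update f a v) fun b hb => Function.update_of_ne hb _ _
  rw [Function.update_self] at h1
  exact Function.eq_update_iff.2 ⟨h1, h2⟩

end CyclicString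

open scoped TensorProduct DirectSum

variable (k : Type u) [Field k] (V : Type*) [Category V] [Preadditive V] [Linear k V]

/-- The module of degree `n` of the additive cyclic nerve: the direct sum over all tuples of
objects `C` of `⨂ i, Hom (C (i + 1)) (C i)`, indexed by the shifted tuple `N i = C (i + 1)`. -/
abbrev CyclicNerveModule (n : ℕ) : Type _ :=
  ⨁ N : Fin (n + 1) → V, ⨂[k] i, (N i ⟶ N (cpred i))

variable {V}

namespace CyclicNerveModule

open scoped Classical in
/-- The elementary tensor `f 0 ⊗ ⋯ ⊗ f n`. -/
def tmul {n : ℕ} (N : Fin (n + 1) → V) (f : CyclicString N) : CyclicNerveModule k V n :=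
  DirectSum.lof k (Fin (n + 1) → V) (fun N => ⨂[k] i, (N i ⟶ N (cpred i))) N
    (PiTensorProduct.tprod k f)

variable {k}

/-- Linear maps out of the additive cyclic nerve are families of multilinear maps. -/
def lift {n : ℕ} {W : Type*} [AddCommGroup W] [Module k W]
    (φ : ∀ N : Fin (n + 1) → V, MultilinearMap k (fun i => (N i ⟶ N (cpred i))) W) :
    CyclicNerveModule k V n →ₗ[k] W :=
  open scoped Classical in
  DirectSum.toModule k _ W fun N => PiTensorProduct.lift (φ N)

@[simp] lemma lift_tmul {n : ℕ} {W : Type*} [AddCommGroup W] [Module k W]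
    (φ : ∀ N : Fin (n + 1) → V, MultilinearMap k (fun i => (N i ⟶ N (cpred i))) W)
    (N : Fin (n + 1) → V) (f : CyclicString N) : lift φ (tmul k N f) = φ N f := by
  classical
  unfold lift tmul
  erw [DirectSum.toModule_lof, PiTensorProduct.lift.tprod]

lemma hom_ext {n : ℕ} {W : Type*} [AddCommGroup W] [Module k W]
    {F G : CyclicNerveModule k V n →ₗ[k] W}
    (h : ∀ N (f : CyclicString N), F (tmul k N f) = G (tmul k N f)) : F = G := by
  classical
  refine DirectSum.linearMap_ext k fun N => PiTensorProduct.ext (MultilinearMap.ext fun f => ?_)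
  exact h N f

/-- The map induced by a monotone `α`: on elementary tensors it is `CyclicString.pull`. -/
def map {m n : ℕ} (α : Fin (m + 1) →o Fin (n + 1)) :
    CyclicNerveModule k V n →ₗ[k] CyclicNerveModule k V m :=
  lift fun N =>
    { toFun := fun f => tmul k (fun j => N (α j)) (CyclicString.pull f α)
      map_update_add' := fun f a v w => by
        classical
        obtain ⟨j, L, hL⟩ := CyclicString.exists_pull_update k f α a
        rw [hL, hL, hL, map_add, tmul, tmul, tmul, MultilinearMap.map_update_add, map_add]
      map_update_smul' := fun f a c v => by
        classical
        obtain ⟨j, L, hL⟩ := CyclicString.exists_pull_update k f α a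
        rw [hL, hL, map_smul, tmul, tmul, MultilinearMap.map_update_smul, map_smul] }

@[simp] lemma map_tmul {m n : ℕ} (α : Fin (m + 1) →o Fin (n + 1)) (N : Fin (n + 1) → V)
    (f : CyclicString N) :
    map α (tmul k N f) = tmul k (fun j => N (α j)) (CyclicString.pull f α) := lift_tmul _ _ _

lemma map_id {n : ℕ} : map (k := k) (V := V) (OrderHom.id : Fin (n + 1) →o Fin (n + 1)) =
    LinearMap.id :=
  hom_ext fun N f => (map_tmul _ _ _).trans (congrArg (tmul k N) f.pull_id)

lemma map_comp {l m n : ℕ} (α : Fin (m + 1) →o Fin (n + 1)) (β : Fin (l + 1) →o Fin (m + 1)) :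
    map (k := k) (V := V) (α.comp β) = map β ∘ₗ map α :=
  hom_ext fun N f => by
    rw [map_tmul, LinearMap.comp_apply, map_tmul, map_tmul]
    exact congrArg (tmul k _) (f.pull_comp α β)

end CyclicNerveModule

end CyclicNerve

section Simplicial

universe v w

variable (k : Type u) [Field k] (V : Type w) [Category.{v} V] [Preadditive V] [Linear k V]

/-- The additive cyclic nerve of a `k`-linear category, as a simplicial `k`-module. -/
def cyclicNerve : SimplicialObject (ModuleCat.{max w v u} k) where
  obj Δ := ModuleCat.of k (CyclicNerveModule k V Δ.unop.len)
  map α := ModuleCat.ofHom (CyclicNerveModule.map α.unop.toOrderHom)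
  map_id Δ := by
    rw [← ModuleCat.ofHom_id]
    exact congrArg ModuleCat.ofHom CyclicNerveModule.map_id
  map_comp α β := by
    rw [← ModuleCat.ofHom_comp]
    exact congrArg ModuleCat.ofHom (CyclicNerveModule.map_comp _ _)

/-- The Hochschild complex of a `k`-linear category: the additive cyclic nerve with the
differential `b = ∑ i, (-1) ^ i d_i`. -/
def hochschildComplex : ChainComplex (ModuleCat.{max w v u} k) ℕ :=
  (AlgebraicTopology.alternatingFaceMapComplex _).obj (cyclicNerve k V)

end Simplicial

section CoarseChains

variable (k : Type u) [Field k] (X : Type u) [BornCoarse X]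

/-- The locally finite controlled `n`-chains `X ^ (n + 1) → k`. -/
def coarseChains (n : ℕ) : Submodule k ((Fin (n + 1) → X) → k) where
  carrier := {c | (∀ B : Set X, Bornology.IsBounded B → {x | c x ≠ 0 ∧ ∃ i, x i ∈ B}.Finite) ∧
    ∃ U, BornCoarse.IsEntourage U ∧ ∀ x, c x ≠ 0 → ∀ i j, (x i, x j) ∈ U}
  zero_mem' := ⟨fun B _ => by simp, _, BornCoarse.diag, by simp⟩
  add_mem' := by
    rintro c d ⟨hc, U, hU, hcU⟩ ⟨hd, V, hV, hdV⟩
    have key : ∀ x, (c + d) x ≠ 0 → c x ≠ 0 ∨ d x ≠ 0 := fun x hx => by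
      by_contra! h
      exact hx (by simp [h.1, h.2])
    refine ⟨fun B hB => ((hc B hB).union (hd B hB)).subset ?_, U ∪ V, BornCoarse.union hU hV, ?_⟩
    · rintro x ⟨hx, hi⟩
      exact (key x hx).imp (fun h => ⟨h, hi⟩) fun h => ⟨h, hi⟩
    · intro x hx i j
      exact (key x hx).imp (fun h => hcU x h i j) fun h => hdV x h i j
  smul_mem' := by
    rintro r c ⟨hc, U, hU, hcU⟩
    have key : ∀ x, (r • c) x ≠ 0 → c x ≠ 0 := fun x hx h => hx (by simp [h])
    exact ⟨fun B hB => (hc B hB).subset fun x hx => ⟨key x hx.1, hx.2⟩, U, hU,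
      fun x hx => hcU x (key x hx)⟩

variable {k X}

namespace coarseChains

variable {l m n : ℕ}

/-- The pushforward of functions along `X ^ (n + 1) → X ^ (m + 1)`, `y ↦ y ∘ α`. -/
def pushFun (α : Fin (m + 1) → Fin (n + 1)) (c : (Fin (n + 1) → X) → k) (x : Fin (m + 1) → X) :
    k := ∑ᶠ (y : Fin (n + 1) → X) (_ : y ∘ α = x), c y

lemma finite_fiber (c : coarseChains k X n) (α : Fin (m + 1) → Fin (n + 1))
    (x : Fin (m + 1) → X) : {y | c.1 y ≠ 0 ∧ y ∘ α = x}.Finite :=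
  (c.2.1 {x 0} Bornology.isBounded_singleton).subset fun _ hy => ⟨hy.1, α 0, congrFun hy.2 0⟩

open scoped Classical in
lemma pushFun_eq {X : Type u} (α : Fin (m + 1) → Fin (n + 1)) (c : (Fin (n + 1) → X) → k)
    (x : Fin (m + 1) → X) (Y : Finset (Fin (n + 1) → X))
    (hY : ∀ y, c y ≠ 0 → y ∘ α = x → y ∈ Y) :
    pushFun α c x = ∑ y ∈ Y with y ∘ α = x, c y := by
  refine finsum_mem_eq_sum_of_inter_support_eq (f := c) (s := {y | y ∘ α = x}) (t := _) ?_
  ext y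
  simp only [Set.mem_inter_iff, Set.mem_ofPred_eq, Function.mem_support, Finset.coe_filter]
  exact ⟨fun h => ⟨⟨hY y h.2 h.1, h.1⟩, h.2⟩, fun h => ⟨h.1.2, h.2⟩⟩

lemma exists_of_pushFun_ne_zero {X : Type u} {α : Fin (m + 1) → Fin (n + 1)}
    {c : (Fin (n + 1) → X) → k} {x : Fin (m + 1) → X} (h : pushFun α c x ≠ 0) : ∃ y, c y ≠ 0 ∧ y ∘ α = x := by
  obtain ⟨y, hy, hy'⟩ := exists_ne_zero_of_finsum_mem_ne_zero (s := {y | y ∘ α = x}) h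
  exact ⟨y, hy', hy⟩

/-- The map on locally finite controlled chains which is the linear extension of
`(x_0, …, x_n) ↦ (x_(α 0), …, x_(α m))`. For the injection omitting `i` it is the face map
`∂_i`. -/
def push (α : Fin (m + 1) → Fin (n + 1)) : coarseChains k X n →ₗ[k] coarseChains k X m where
  toFun c := ⟨pushFun α c.1, by
    refine ⟨fun B hB => ((c.2.1 B hB).image fun y => y ∘ α).subset ?_, ?_⟩
    · rintro x ⟨hx, i, hi⟩
      obtain ⟨y, hy, rfl⟩ := exists_of_pushFun_ne_zero hx
      exact ⟨y, ⟨hy, α i, hi⟩, rfl⟩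
    · obtain ⟨U, hU, h⟩ := c.2.2
      refine ⟨U, hU, fun x hx i j => ?_⟩
      obtain ⟨y, hy, rfl⟩ := exists_of_pushFun_ne_zero hx
      exact h y hy _ _⟩
  map_add' c d := Subtype.ext (funext fun x => by
    classical
    have hY := (finite_fiber c α x).union (finite_fiber d α x)
    have h : ∀ y, y ∘ α = x → c.1 y ≠ 0 ∨ d.1 y ≠ 0 → y ∈ hY.toFinset := fun y hy h =>
      hY.mem_toFinset.2 (h.imp (fun h => ⟨h, hy⟩) fun h => ⟨h, hy⟩)
    change pushFun α (c.1 + d.1) x = pushFun α c.1 x + pushFun α d.1 x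
    rw [pushFun_eq α (c.1 + d.1) x hY.toFinset, pushFun_eq α c.1 x hY.toFinset,
      pushFun_eq α d.1 x hY.toFinset, ← Finset.sum_add_distrib]
    · rfl
    · exact fun y hy hx => h y hx (Or.inr hy)
    · exact fun y hy hx => h y hx (Or.inl hy)
    · refine fun y hy hx => h y hx ?_
      by_contra! h
      exact hy (by simp [h.1, h.2]))
  map_smul' r c := Subtype.ext (funext fun x => by
    classical
    have hY := finite_fiber c α x
    change pushFun α (r • c.1) x = r * pushFun α c.1 x
    rw [pushFun_eq α (r • c.1) x hY.toFinset, pushFun_eq α c.1 x hY.toFinset, Finset.mul_sum]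
    · rfl
    · exact fun y hy hx => hY.mem_toFinset.2 ⟨hy, hx⟩
    · exact fun y hy hx => hY.mem_toFinset.2 ⟨fun h => hy (by simp [h]), hx⟩)

lemma push_id : push (k := k) (X := X) (id : Fin (n + 1) → Fin (n + 1)) = LinearMap.id := by
  refine LinearMap.ext fun c => Subtype.ext (funext fun x => ?_)
  change ∑ᶠ (y : Fin (n + 1) → X) (_ : y = x), c.1 y = c.1 x
  exact finsum_mem_singleton (f := c.1)

lemma push_comp (α : Fin (m + 1) → Fin (n + 1)) (β : Fin (l + 1) → Fin (m + 1)) :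
    push (k := k) (X := X) (α ∘ β) = push β ∘ₗ push α := by
  classical
  refine LinearMap.ext fun c => Subtype.ext (funext fun x => ?_)
  have hY := finite_fiber c (α ∘ β) x
  have h : ∀ y, c.1 y ≠ 0 → y ∘ (α ∘ β) = x → y ∈ hY.toFinset := fun y hy hx =>
    hY.mem_toFinset.2 ⟨hy, hx⟩
  change pushFun (α ∘ β) c.1 x = pushFun β (pushFun α c.1) x
  rw [pushFun_eq _ _ _ hY.toFinset h,
    pushFun_eq β (pushFun α c.1) x (hY.toFinset.image fun y => y ∘ α)]
  · rw [Finset.sum_congr rfl (g := fun z => ∑ y ∈ hY.toFinset with y ∘ α = z, c.1 y)]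
    · rw [← Finset.sum_fiberwise_of_maps_to (g := fun y => y ∘ α)
        (t := {z ∈ hY.toFinset.image fun y => y ∘ α | z ∘ β = x})]
      · refine Finset.sum_congr rfl fun z hz => Finset.sum_congr ?_ fun _ _ => rfl
        ext y
        have := (Finset.mem_filter.1 hz).2
        simp only [Finset.mem_filter]
        constructor
        · exact fun h => ⟨h.1.1, h.2⟩
        · rintro ⟨h1, rfl⟩
          exact ⟨⟨h1, this⟩, rfl⟩
      · intro y hy
        have hy := Finset.mem_filter.1 hy
        exact Finset.mem_filter.2 ⟨Finset.mem_image_of_mem _ hy.1, hy.2⟩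
    · intro z hz
      refine pushFun_eq α c.1 z _ fun y hy hz' => h y hy ?_
      rw [← (Finset.mem_filter.1 hz).2, ← hz']
      rfl
  · intro z hz hzx
    obtain ⟨y, hy, rfl⟩ := exists_of_pushFun_ne_zero hz
    exact Finset.mem_image_of_mem _ (h y hy hzx)

end coarseChains

variable (k X)

/-- The locally finite controlled chains as a simplicial `k`-module. The universe lift makes it
comparable with the additive cyclic nerve of the (large) category of controlled objects. -/
def coarseChainsSimplicial : SimplicialObject (ModuleCat.{u + 1} k) where
  obj Δ := ModuleCat.of k (ULift.{u + 1} (coarseChains k X Δ.unop.len))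
  map α := ModuleCat.ofHom (ULift.moduleEquiv.symm.toLinearMap ∘ₗ
    coarseChains.push α.unop.toOrderHom ∘ₗ ULift.moduleEquiv.toLinearMap)
  map_id Δ := by
    rw [← ModuleCat.ofHom_id]
    refine congrArg ModuleCat.ofHom (LinearMap.ext fun c => ?_)
    exact congrArg ULift.up (LinearMap.congr_fun coarseChains.push_id c.down)
  map_comp α β := by
    rw [← ModuleCat.ofHom_comp]
    refine congrArg ModuleCat.ofHom (LinearMap.ext fun c => ?_)
    have h := LinearMap.congr_fun (coarseChains.push_comp (k := k) (X := X)
      α.unop.toOrderHom β.unop.toOrderHom) c.down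
    exact congrArg ULift.up h

/-- The complex `XC_*(X)` of locally finite controlled chains with coefficients in `k`, with
differential `∂ = ∑ i, (-1) ^ i ∂_i`; it computes coarse ordinary homology. -/
def coarseChainComplex : ChainComplex (ModuleCat.{u + 1} k) ℕ :=
  (AlgebraicTopology.alternatingFaceMapComplex _).obj (coarseChainsSimplicial k X)

end CoarseChains

variable {k : Type u} [Field k] {X : Type u} [BornCoarse X]

namespace ControlledObject

lemma pt_le {x : X} {B : Bdd X} (h : x ∈ B.1) : Bdd.pt x ≤ B := Set.singleton_subset_iff.2 h

lemma incl_proj_self (M : ControlledObject k X) {B : Bdd X} {x : X} (h : Bdd.pt x ≤ B) :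
    M.incl h ≫ M.proj B x = 𝟙 _ := by
  rw [proj, incl_incl_assoc]
  exact IsPushout.inl_desc _ _ _ _

lemma incl_proj_ne (M : ControlledObject k X) {B : Bdd X} {x y : X} (h : Bdd.pt y ≤ B)
    (hxy : y ≠ x) : M.incl h ≫ M.proj B x = 0 := by
  have h1 : Bdd.pt y ≤ B.erase x := pt_le ⟨h rfl, hxy⟩
  have h2 := (M.isPushout (Bdd.pt x) (B.erase x)).inr_desc (𝟙 _) 0
    (IsZero.eq_of_src (by rw [Bdd.pt_inter_erase]; exact M.isZero_empty) _ _)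
  rw [proj, incl_incl_assoc, ← M.incl_incl_assoc h1 (Bdd.le_union_right _ _)]
  refine (congrArg (fun t => M.incl h1 ≫ t) h2).trans ?_
  exact Limits.comp_zero

lemma hom_ext_of_finite (M : ControlledObject k X) {Z : FGModuleCat.{u} k} (s : Set X)
    (hs : s.Finite) : ∀ (hb : Bornology.IsBounded s) (g g' : M.M.obj ⟨s, hb⟩ ⟶ Z),
      (∀ y (hy : Bdd.pt y ≤ ⟨s, hb⟩), M.incl hy ≫ g = M.incl hy ≫ g') → g = g' := by
  induction s, hs using Set.Finite.induction_on with
  | empty => exact fun _ g g' _ => M.isZero_empty.eq_of_src g g'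
  | @insert a s _ _ ih =>
    intro hb g g' h
    have hs : Bornology.IsBounded s := hb.subset (Set.subset_insert _ _)
    have h1 : Bdd.pt a ∪ ⟨s, hs⟩ ≤ (⟨insert a s, hb⟩ : Bdd X) := fun _ h => h
    have h2 : (⟨insert a s, hb⟩ : Bdd X) ≤ Bdd.pt a ∪ ⟨s, hs⟩ := fun _ h => h
    have key : M.incl h1 ≫ g = M.incl h1 ≫ g' := by
      refine (M.isPushout (Bdd.pt a) ⟨s, hs⟩).hom_ext ?_ ?_
      · change M.incl _ ≫ M.incl _ ≫ g = M.incl _ ≫ M.incl _ ≫ g'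
        rw [incl_incl_assoc, incl_incl_assoc]
        exact h a _
      · change M.incl _ ≫ M.incl _ ≫ g = M.incl _ ≫ M.incl _ ≫ g'
        refine ih hs _ _ fun y hy => ?_
        rw [incl_incl_assoc, incl_incl_assoc, incl_incl_assoc, incl_incl_assoc]
        exact h y _
    have := congrArg (fun t => M.incl h2 ≫ t) key
    simpa only [incl_incl_assoc, incl_self, Category.id_comp] using this

/-- Morphisms out of `M(B)` are determined on finitely many points. -/
lemma exists_finset (M : ControlledObject k X) (B : Bdd X) :
    ∃ F : Finset X, (∀ x ∈ F, x ∈ B.1) ∧ ∀ (Z : FGModuleCat.{u} k) (g g' : M.M.obj B ⟶ Z),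
      (∀ y ∈ F, ∀ hy : Bdd.pt y ≤ B, M.incl hy ≫ g = M.incl hy ≫ g') → g = g' := by
  obtain ⟨F, hF, hfin, hiso⟩ := M.finite_support B
  refine ⟨hfin.toFinset, fun x hx => hF (hfin.mem_toFinset.1 hx), fun Z g g' h => ?_⟩
  have hiso : IsIso (M.incl hF) := hiso
  refine (cancel_epi (M.incl hF)).1 (M.hom_ext_of_finite F.1 hfin F.2 _ _ fun y hy => ?_)
  have := h y (hfin.mem_toFinset.2 (hy rfl)) (hy.trans hF)
  rw [← M.incl_incl hy hF] at this
  simpa only [Category.assoc] using this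

lemma incl_proj (M : ControlledObject k X) {B C : Bdd X} (h : B ≤ C) (x : X) :
    M.incl h ≫ M.proj C x = M.proj B x := by
  obtain ⟨F, -, hF⟩ := M.exists_finset B
  refine hF _ _ _ fun y _ hy => ?_
  rw [incl_incl_assoc]
  by_cases hxy : y = x
  · subst hxy
    rw [incl_proj_self, incl_proj_self]
  · rw [incl_proj_ne _ _ hxy, incl_proj_ne _ _ hxy]

lemma exists_finset_proj (M : ControlledObject k X) (B : Bdd X) :
    ∃ F : Finset X, (∀ x ∈ F, x ∈ B.1) ∧ ∀ x ∉ F, M.proj B x = 0 := by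
  obtain ⟨F, hF, h⟩ := M.exists_finset B
  refine ⟨F, hF, fun x hx => h _ _ _ fun y hy hy' => ?_⟩
  have hyx : y ≠ x := by
    rintro rfl
    exact hx hy
  rw [incl_proj_ne _ _ hyx, Limits.comp_zero]

lemma proj_eq_zero (M : ControlledObject k X) {B : Bdd X} {x : X} (hx : x ∉ B.1) :
    M.proj B x = 0 := by
  obtain ⟨F, hF, h⟩ := M.exists_finset_proj B
  exact h x fun h => hx (hF x h)

lemma finite_nonzero (M : ControlledObject k X) (B : Bdd X) :
    {x | x ∈ B.1 ∧ 𝟙 (M.M.obj (Bdd.pt x)) ≠ 0}.Finite := by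
  obtain ⟨F, -, h⟩ := M.exists_finset_proj B
  refine F.finite_toSet.subset fun x hx => ?_
  by_contra hF
  refine hx.2 ?_
  rw [← M.incl_proj_self (pt_le hx.1), h x hF, Limits.comp_zero]

/-- Decomposition of a composite through `M(B) = ⨁ x ∈ B, M(x)`. -/
lemma comp_eq_sum (M : ControlledObject k X) {B : Bdd X} {Z Z' : FGModuleCat.{u} k}
    (e : Z ⟶ M.M.obj B) (g : M.M.obj B ⟶ Z') (g' : ∀ y, M.M.obj (Bdd.pt y) ⟶ Z')
    (hg : ∀ y (hy : Bdd.pt y ≤ B), M.incl hy ≫ g = g' y) (F : Finset X)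
    (hF : ∀ y ∉ F, e ≫ M.proj B y = 0) :
    e ≫ g = ∑ y ∈ F, (e ≫ M.proj B y) ≫ g' y := by
  classical
  obtain ⟨F', -, h⟩ := M.exists_finset B
  have hgF : g = ∑ y ∈ F ∪ F', M.proj B y ≫ g' y := by
    refine h _ _ _ fun y hy hy' => ?_
    rw [Preadditive.comp_sum, Finset.sum_eq_single y]
    · rw [← Category.assoc, incl_proj_self, Category.id_comp, hg]
    · intro z _ hz
      rw [← Category.assoc, incl_proj_ne _ _ hz.symm, Limits.zero_comp]
    · exact fun hn => absurd (Finset.mem_union_right _ hy) hn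
  conv_lhs => rw [hgF]
  rw [Preadditive.comp_sum]
  symm
  refine (Finset.sum_subset Finset.subset_union_left fun y _ hy => ?_).trans
    (Finset.sum_congr rfl fun y _ => Category.assoc _ _ _)
  rw [hF y hy, Limits.zero_comp]

/-- The linear map `M(x) ⟶ N(y)` induced by a `U`-controlled morphism. -/
def morEntry (M N : ControlledObject k X) (x y : X) (U : Ent X) :
    Mor M N U →ₗ[k] (M.M.obj (Bdd.pt x) ⟶ N.M.obj (Bdd.pt y)) where
  toFun a := a.at (Bdd.pt x) ≫ N.proj _ y
  map_add' _ _ := Preadditive.add_comp _ _ _ _ _ _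
  map_smul' _ _ := Linear.smul_comp _ _ _ _ _ _

/-- The linear map `M(x) ⟶ N(y)` induced by a controlled morphism `M ⟶ N`: the composite
`M(x) ⟶ N(U[x]) = ⨁ z ∈ U[x], N(z) ⟶ N(y)`. -/
def entry {M N : ControlledObject k X} (x y : X) :
    (M ⟶ N) →ₗ[k] (M.M.obj (Bdd.pt x) ⟶ N.M.obj (Bdd.pt y)) :=
  DirectLimit.Module.lift k (Ent X) (Mor M N) (morTrans M N) (morEntry M N x y)
    fun U V h a => by
      change (morTrans M N U V h a).at _ ≫ N.proj _ y = a.at _ ≫ N.proj _ y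
      rw [morTrans_at, Category.assoc, incl_proj]

lemma entry_of {M N : ControlledObject k X} (x y : X) {U : Ent X} (a : Mor M N U) :
    entry x y (M := M) (N := N) (Hom.of U a) = a.at (Bdd.pt x) ≫ N.proj _ y := rfl

lemma entry_id (M : ControlledObject k X) (x : X) : entry x x (𝟙 M) = 𝟙 _ :=
  (entry_of x x M.morId).trans (M.incl_proj_self _)

lemma exists_finset_entry {M N : ControlledObject k X} (f : M ⟶ N) (x : X) :
    ∃ F : Finset X, ∀ y ∉ F, entry x y f = 0 := by
  obtain ⟨U, a, rfl⟩ := Hom.exists_of f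
  obtain ⟨F, -, h⟩ := N.exists_finset_proj (U.thick (Bdd.pt x))
  refine ⟨F, fun y hy => ?_⟩
  rw [entry_of, h y hy, Limits.comp_zero]

lemma exists_ent {M N : ControlledObject k X} (f : M ⟶ N) :
    ∃ U : Ent X, ∀ x y, entry x y f ≠ 0 → (y, x) ∈ U.1 := by
  obtain ⟨U, a, rfl⟩ := Hom.exists_of f
  refine ⟨U, fun x y h => ?_⟩
  by_contra hU
  refine h ?_
  rw [entry_of, N.proj_eq_zero, Limits.comp_zero]
  rintro ⟨b, rfl, hb⟩
  exact hU hb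

lemma entry_comp {M N P : ControlledObject k X} (f : M ⟶ N) (g : N ⟶ P) (x z : X) (F : Finset X)
    (hF : ∀ y ∉ F, entry x y f = 0) :
    entry x z (f ≫ g) = ∑ y ∈ F, entry x y f ≫ entry y z g := by
  obtain ⟨U, a, rfl⟩ := Hom.exists_of f
  obtain ⟨V, b, rfl⟩ := Hom.exists_of g
  refine (entry_of x z (morComp a b)).trans ?_
  rw [morComp_at, Category.assoc, Category.assoc, incl_proj]
  refine N.comp_eq_sum _ _ (fun y => b.at (Bdd.pt y) ≫ P.proj _ z) (fun y hy => ?_) F hF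
  rw [← Category.assoc, b.incl_at, Category.assoc, incl_proj]

end ControlledObject

section Trace

variable {m n : ℕ}

/-- The trace of the cyclic composite `W n ⟶ W (n - 1) ⟶ ⋯ ⟶ W 0 ⟶ W n`. -/
def cyclicTrace {W : Fin (n + 1) → FGModuleCat.{u} k} (A : CyclicString W) : k :=
  LinearMap.trace k (W (Fin.last n)) (A.down (Fin.zero_le (Fin.last n)) ≫ A.close).hom.hom

lemma trace_comm {W W' : FGModuleCat.{u} k} (a : W ⟶ W') (b : W' ⟶ W) :
    LinearMap.trace k W (a ≫ b).hom.hom = LinearMap.trace k W' (b ≫ a).hom.hom :=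
  LinearMap.trace_comp_comm' a.hom.hom b.hom.hom

lemma cyclicTrace_pull {W : Fin (n + 1) → FGModuleCat.{u} k} (A : CyclicString W)
    (α : Fin (m + 1) →o Fin (n + 1)) : cyclicTrace (A.pull α) = cyclicTrace A := by
  unfold cyclicTrace
  rw [CyclicString.down_pull, CyclicString.close_pull, CyclicString.down_down_assoc,
    ← Category.assoc, trace_comm, CyclicString.down_down_assoc]

lemma cyclicTrace_fin_one {W : Fin (0 + 1) → FGModuleCat.{u} k} (A : CyclicString W) :
    cyclicTrace A = LinearMap.trace k (W 0) (CyclicString.close A).hom.hom := by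
  have h : A.down (Fin.zero_le (Fin.last 0)) = 𝟙 (W 0) := A.down_self _
  exact congrArg (fun t : W 0 ⟶ W 0 => LinearMap.trace k (W 0) t.hom.hom)
    ((congrArg (fun t : W 0 ⟶ W 0 => t ≫ A.close) h).trans (Category.id_comp _))

lemma exists_cyclicTrace_update [DecidableEq (Fin (n + 1))] {W : Fin (n + 1) → FGModuleCat.{u} k}
    (A : CyclicString W) (i : Fin (n + 1)) :
    ∃ L : (W i ⟶ W (cpred i)) →ₗ[k] k, ∀ v, cyclicTrace (Function.update A i v) = L v := by
  let α : Fin (0 + 1) →o Fin (n + 1) := ⟨fun _ => 0, fun _ _ _ => le_rfl⟩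
  obtain ⟨j, L, h⟩ := CyclicString.exists_pull_update k A α i
  obtain rfl : j = 0 := Fin.fin_one_eq_zero j
  let T : (W 0 ⟶ W 0) →ₗ[k] k :=
    { toFun := fun t => LinearMap.trace k (W 0) t.hom.hom
      map_add' := fun a b => map_add (LinearMap.trace k (W 0)) a.hom.hom b.hom.hom
      map_smul' := fun c a => map_smul (LinearMap.trace k (W 0)) c a.hom.hom }
  refine ⟨T ∘ₗ L, fun v => ?_⟩
  rw [← cyclicTrace_pull _ α, h, cyclicTrace_fin_one]
  exact congrArg T (Function.update_self _ _ _)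

/-- The cyclic trace as a multilinear map. -/
def cyclicTraceMultilinear (W : Fin (n + 1) → FGModuleCat.{u} k) :
    MultilinearMap k (fun i => (W i ⟶ W (cpred i))) k where
  toFun A := cyclicTrace A
  map_update_add' A i v w := by
    obtain ⟨L, h⟩ := exists_cyclicTrace_update A i
    rw [h, h, h, map_add]
  map_update_smul' A i c v := by
    obtain ⟨L, h⟩ := exists_cyclicTrace_update A i
    rw [h, h, map_smul]

end Trace

section Phi

variable {m n : ℕ} {N : Fin (n + 1) → ControlledObject k X}

open ControlledObject

/-- The linear maps `N i (x i) ⟶ N (i - 1) (x (i - 1))` induced by a cyclic string of controlled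
morphisms at a point `x` of `X ^ (n + 1)`. -/
def entries (f : CyclicString N) (x : Fin (n + 1) → X) :
    CyclicString (fun i => (N i).M.obj (Bdd.pt (x i))) :=
  fun i => entry (x i) (x (cpred i)) (f i)

lemma entries_ne_zero {f : CyclicString N} {x : Fin (n + 1) → X}
    (h : cyclicTrace (entries f x) ≠ 0) (i : Fin (n + 1)) :
    entry (x i) (x (cpred i)) (f i) ≠ 0 := fun h0 =>
  h ((cyclicTraceMultilinear fun i => (N i).M.obj (Bdd.pt (x i))).map_coord_zero i h0)

lemma exists_ent_chain (U : Ent X) (hU : Ent.diag ≤ U) (n : ℕ) :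
    ∃ W : Ent X, ∀ x : Fin (n + 1) → X, (∀ i : Fin n, (x i.castSucc, x i.succ) ∈ U.1) →
      ∀ i j, (x i, x j) ∈ W.1 := by
  obtain ⟨E, hE⟩ : ∃ E : Ent X, ∀ x : Fin (n + 1) → X,
      (∀ i : Fin n, (x i.castSucc, x i.succ) ∈ U.1) → ∀ i j, i ≤ j → (x i, x j) ∈ E.1 := by
    induction n with
    | zero =>
      refine ⟨Ent.diag, fun x _ i j _ => ?_⟩
      obtain rfl : i = 0 := Fin.fin_one_eq_zero i
      obtain rfl : j = 0 := Fin.fin_one_eq_zero j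
      rfl
    | succ n ih =>
      obtain ⟨E, hE⟩ := ih
      refine ⟨E.comp U, fun x hx i j hij => ?_⟩
      have hd : ∀ i j : Fin (n + 1), i ≤ j → (x i.castSucc, x j.castSucc) ∈ E.1 :=
        hE (fun i => x i.castSucc) fun i => hx i.castSucc
      revert hij
      refine Fin.lastCases ?_ (fun j => ?_) j
      · refine Fin.lastCases (fun _ => ?_) (fun i _ => ?_) i
        · exact ⟨_, hE (fun _ => x (Fin.last (n + 1))) (fun _ => hU rfl) 0 0 le_rfl, hU rfl⟩
        · exact ⟨_, hd i (Fin.last n) (Fin.le_last _), hx (Fin.last n)⟩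
      · intro hij
        have hi : i.1 < n + 1 := lt_of_le_of_lt hij j.2
        exact ⟨_, hd ⟨i.1, hi⟩ j hij, hU rfl⟩
  refine ⟨⟨_, BornCoarse.union E.2 (BornCoarse.inv E.2)⟩, fun x hx i j => ?_⟩
  rcases le_total i j with h | h
  · exact Or.inl (hE x hx i j h)
  · exact Or.inr (hE x hx j i h)

lemma phi_mem (f : CyclicString N) :
    (fun x => cyclicTrace (entries f x)) ∈ coarseChains k X n := by
  choose U hU using fun i => exists_ent (f i)
  obtain ⟨U', hU'⟩ := Finite.exists_le U
  obtain ⟨U'', h1, h2⟩ := exists_ge_ge U' Ent.diag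
  obtain ⟨W, hW⟩ := exists_ent_chain U'' h2 n
  have hctr : ∀ x, cyclicTrace (entries f x) ≠ 0 → ∀ i j, (x i, x j) ∈ W.1 := fun x hx =>
    hW x fun i => h1 (hU' i.succ (hU i.succ _ _ (entries_ne_zero hx i.succ)))
  refine ⟨fun B hB => ?_, W.1, W.2, hctr⟩
  refine (Set.Finite.pi' fun j => (N j).finite_nonzero (W.thick ⟨B, hB⟩)).subset ?_
  rintro x ⟨hx, i, hi⟩ j
  refine ⟨⟨x i, hi, hctr x hx j i⟩, fun h0 => entries_ne_zero hx j ?_⟩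
  rw [← Category.id_comp (entry (x j) (x (cpred j)) (f j)), h0, Limits.zero_comp]

/-- `φ` on tuples of morphisms: the chain `∑ x, tr ((f 0 ∘ ⋯ ∘ f n) | x) • x`. -/
def phiMultilinear (N : Fin (n + 1) → ControlledObject k X) :
    MultilinearMap k (fun i => (N i ⟶ N (cpred i))) (coarseChains k X n) :=
  (MultilinearMap.pi fun x : Fin (n + 1) → X =>
    (cyclicTraceMultilinear fun i => (N i).M.obj (Bdd.pt (x i))).compLinearMap
      fun i => entry (x i) (x (cpred i))).codRestrict (coarseChains k X n) phi_mem

variable (k X) in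
/-- The map `φ_n` from the additive cyclic nerve of the category of controlled objects to locally
finite controlled chains. -/
def phi (n : ℕ) : CyclicNerveModule k (ControlledObject k X) n →ₗ[k] coarseChains k X n :=
  CyclicNerveModule.lift phiMultilinear

lemma phi_tmul (f : CyclicString N) (x : Fin (n + 1) → X) :
    (phi k X n (CyclicNerveModule.tmul k N f)).1 x = cyclicTrace (entries f x) := by
  rw [phi, CyclicNerveModule.lift_tmul]
  rfl

lemma entries_down (f : CyclicString N) (y : Fin (n + 1) → X) {a b : Fin (n + 1)} (h : a ≤ b)
    (hab : b.1 ≤ a.1 + 1) : (entries f y).down h = entry (y b) (y a) (f.down h) := by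
  rcases h.eq_or_lt with rfl | hlt
  · rw [CyclicString.down_self, CyclicString.down_self, entry_id]
  · obtain ⟨c, rfl⟩ := Fin.exists_succ_eq.2 (Fin.ne_zero_of_lt hlt)
    obtain rfl : a = c.castSucc := Fin.ext (by
      have : a.1 < c.1 + 1 := hlt
      have : c.1 + 1 ≤ a.1 + 1 := hab
      simp only [Fin.val_castSucc]
      omega)
    rw [CyclicString.down_step, CyclicString.down_step]
    rfl

lemma entries_close_down (f : CyclicString N) (y : Fin (n + 1) → X) {b : Fin (n + 1)}
    (h : b ≤ Fin.last n) (hb : b = Fin.last n) :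
    (entries f y).close ≫ (entries f y).down h = entry (y 0) (y b) (f.close ≫ f.down h) := by
  subst hb
  rw [CyclicString.down_self, CyclicString.down_self, Category.comp_id, Category.comp_id]
  rfl

lemma entries_down_close (f : CyclicString N) (y : Fin (n + 1) → X) {a : Fin (n + 1)}
    (h : 0 ≤ a) (ha : a = 0) :
    (entries f y).down h ≫ (entries f y).close =
      entry (y a) (y (Fin.last n)) (f.down h ≫ f.close) := by
  subst ha
  rw [CyclicString.down_self, CyclicString.down_self, Category.id_comp, Category.id_comp]
  rfl

lemma exists_sum_entry {M M' M'' : ControlledObject k X} (a : M ⟶ M') (b : M' ⟶ M'') (p q : X) :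
    ∃ F : Finset X, (∀ z ∉ F, entry p z a ≫ entry z q b = 0) ∧
      entry p q (a ≫ b) = ∑ z ∈ F, entry p z a ≫ entry z q b := by
  obtain ⟨F, hF⟩ := exists_finset_entry a p
  exact ⟨F, fun z hz => by rw [hF z hz, Limits.zero_comp], entry_comp a b p q F hF⟩

lemma exists_cyclicTrace_close {W : Fin (n + 1) → FGModuleCat.{u} k}
    (s : ∀ i : Fin n, W i.succ ⟶ W i.castSucc) :
    ∃ L : (W 0 ⟶ W (Fin.last n)) →ₗ[k] k, ∀ b, cyclicTrace (CyclicString.ofClose b s) = L b := by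
  obtain ⟨L, hL⟩ := exists_cyclicTrace_update (CyclicString.ofClose 0 s) 0
  refine ⟨L, fun b => (congrArg cyclicTrace ?_).trans (hL b)⟩
  refine Function.eq_update_iff.2 ⟨rfl, ?_⟩
  exact Fin.cases (fun h => absurd rfl h) fun a _ => rfl

lemma exists_cyclicTrace_step {W : Fin (n + 1) → FGModuleCat.{u} k} (c : W 0 ⟶ W (Fin.last n))
    (s : ∀ i : Fin n, W i.succ ⟶ W i.castSucc) (j : Fin n) :
    ∃ L : (W j.succ ⟶ W j.castSucc) →ₗ[k] k,
      ∀ b, cyclicTrace (CyclicString.ofClose c (Function.update s j b)) = L b := by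
  obtain ⟨L, hL⟩ := exists_cyclicTrace_update (CyclicString.ofClose c s) j.succ
  refine ⟨L, fun b => (congrArg cyclicTrace ?_).trans (hL b)⟩
  refine Function.eq_update_iff.2 ⟨Function.update_self _ _ _, ?_⟩
  exact Fin.cases (fun _ => rfl) fun a ha =>
    Function.update_of_ne (fun h => ha (congrArg Fin.succ h)) _ _

/-- The statement that the chain of `f.pull α` at `x` is the sum of the values of the chain of `f`
at the points `y` with `y ∘ α = x`, which are determined by `y i`. -/
def FaceSum (f : CyclicString N) (α : Fin (m + 1) →o Fin (n + 1)) (i : Fin (n + 1))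
    (x : Fin (m + 1) → X) : Prop :=
  ∃ (T : X → k) (F : Finset X), (∀ z ∉ F, T z = 0) ∧
    cyclicTrace (entries (f.pull α) x) = ∑ z ∈ F, T z ∧
      ∀ y : Fin (n + 1) → X, y ∘ α = x → cyclicTrace (entries f y) = T (y i)

lemma faceSum_of_close (f : CyclicString N) (α : Fin (m + 1) →o Fin (n + 1)) (i : Fin (n + 1))
    (x : Fin (m + 1) → X) (a : N (α 0) ⟶ N i) (b : N i ⟶ N (α (Fin.last m)))
    (hab : (f.pull α).close = a ≫ b)
    (hc : ∀ y : Fin (n + 1) → X, ((entries f y).pull α).close =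
      entry (y (α 0)) (y i) a ≫ entry (y i) (y (α (Fin.last m))) b)
    (hs : ∀ (y : Fin (n + 1) → X) (j : Fin m), ((entries f y).pull α).step j =
      entry (y (α j.succ)) (y (α j.castSucc)) ((f.pull α).step j)) : FaceSum f α i x := by
  obtain ⟨F, hF, hsum⟩ := exists_sum_entry a b (x 0) (x (Fin.last m))
  obtain ⟨L, hL⟩ := exists_cyclicTrace_close
    (W := fun j => (N (α j)).M.obj (Bdd.pt (x j))) (entries (f.pull α) x).step
  refine ⟨fun z => L (entry (x 0) z a ≫ entry z (x (Fin.last m)) b), F, fun z hz => ?_, ?_,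
    fun y hy => ?_⟩
  · beta_reduce
    rw [hF z hz, map_zero]
  · rw [← map_sum, ← hsum, ← hab, ← hL]
    exact congrArg cyclicTrace (CyclicString.ext' rfl fun _ => rfl)
  · subst hy
    beta_reduce
    rw [← hL, ← cyclicTrace_pull (entries f y) α]
    exact congrArg cyclicTrace (CyclicString.ext' (hc y) (hs y))

lemma step_update_self {V : Type*} [Category V] {W : Fin (n + 1) → V}
    (c : W 0 ⟶ W (Fin.last n)) (s : ∀ i : Fin n, W i.succ ⟶ W i.castSucc) (j : Fin n)
    (b : W j.succ ⟶ W j.castSucc) :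
    (CyclicString.ofClose c (Function.update s j b)).step j = b := by
  rw [CyclicString.step_ofClose, Function.update_self]

lemma step_update_ne {V : Type*} [Category V] {W : Fin (n + 1) → V}
    (c : W 0 ⟶ W (Fin.last n)) (s : ∀ i : Fin n, W i.succ ⟶ W i.castSucc) (j : Fin n)
    (b : W j.succ ⟶ W j.castSucc) (l : Fin n) (hl : l ≠ j) :
    (CyclicString.ofClose c (Function.update s j b)).step l = s l := by
  rw [CyclicString.step_ofClose, Function.update_of_ne hl]

lemma faceSum_of_step (f : CyclicString N) (α : Fin (m + 1) →o Fin (n + 1)) (i : Fin (n + 1))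
    (x : Fin (m + 1) → X) (j : Fin m) (a : N (α j.succ) ⟶ N i) (b : N i ⟶ N (α j.castSucc))
    (hab : (f.pull α).step j = a ≫ b)
    (hj : ∀ y : Fin (n + 1) → X, ((entries f y).pull α).step j =
      entry (y (α j.succ)) (y i) a ≫ entry (y i) (y (α j.castSucc)) b)
    (hc : ∀ y : Fin (n + 1) → X, ((entries f y).pull α).close =
      entry (y (α 0)) (y (α (Fin.last m))) (f.pull α).close)
    (hs : ∀ (y : Fin (n + 1) → X) (l : Fin m), l ≠ j → ((entries f y).pull α).step l =
      entry (y (α l.succ)) (y (α l.castSucc)) ((f.pull α).step l)) : FaceSum f α i x := by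
  obtain ⟨F, hF, hsum⟩ := exists_sum_entry a b (x j.succ) (x j.castSucc)
  obtain ⟨L, hL⟩ := exists_cyclicTrace_step
    (W := fun j => (N (α j)).M.obj (Bdd.pt (x j))) (entries (f.pull α) x).close
    (entries (f.pull α) x).step j
  refine ⟨fun z => L (entry (x j.succ) z a ≫ entry z (x j.castSucc) b), F, fun z hz => ?_, ?_,
    fun y hy => ?_⟩
  · beta_reduce
    rw [hF z hz, map_zero]
  · rw [← map_sum, ← hsum, ← hab, ← hL]
    refine congrArg cyclicTrace (CyclicString.ext' rfl fun l => ?_)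
    have h := Function.update_eq_self j (entries (f.pull α) x).step
    exact (congrFun h l).symm
  · subst hy
    beta_reduce
    rw [← hL, ← cyclicTrace_pull (entries f y) α]
    refine congrArg cyclicTrace (CyclicString.ext' (hc y) fun l => ?_)
    by_cases hl : l = j
    · subst hl
      refine (hj y).trans ?_
      exact (step_update_self (W := fun j => (N (α j)).M.obj (Bdd.pt (y (α j)))) _ _ l _).symm
    · refine (hs y l hl).trans ?_
      exact (step_update_ne (W := fun j => (N (α j)).M.obj (Bdd.pt (y (α j))))
        (entries (f.pull α) (y ∘ α)).close (entries (f.pull α) (y ∘ α)).step j _ l hl).symm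

lemma entries_down_zero (f : CyclicString N) (y : Fin (n + 1) → X) {b c : Fin (n + 1)}
    (hb : b = 0) (g : N 0 ⟶ N c) :
    (entries f y).down (Fin.zero_le b) ≫ entry (y 0) (y c) g =
      entry (y b) (y c) (f.down (Fin.zero_le b) ≫ g) := by
  subst hb
  rw [CyclicString.down_self, CyclicString.down_self, Category.id_comp, Category.id_comp]

lemma faceSum_first (f : CyclicString N) (α : Fin (m + 1) →o Fin (n + 1))
    (x : Fin (m + 1) → X) (h0 : (α 0).1 ≤ 1) (hl : α (Fin.last m) = Fin.last n)
    (hs : ∀ j : Fin m, (α j.succ).1 ≤ (α j.castSucc).1 + 1) : FaceSum f α 0 x := by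
  refine faceSum_of_close f α 0 x (f.down (Fin.zero_le (α 0)))
    (f.close ≫ f.down (Fin.le_last (α (Fin.last m)))) ?_ (fun y => ?_) fun y j => ?_
  · exact f.close_pull α
  · have h1 := entries_down f y (Fin.zero_le (α 0)) (h0.trans (Nat.le_add_left _ _))
    have h2 := entries_close_down f y (Fin.le_last (α (Fin.last m))) hl
    exact congrArg₂ (fun a b => a ≫ b) h1 h2
  · exact entries_down f y _ (hs j)

lemma faceSum_last (f : CyclicString N) (α : Fin (m + 1) →o Fin (n + 1))
    (x : Fin (m + 1) → X) (h0 : α 0 = 0) (hl : n ≤ (α (Fin.last m)).1 + 1)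
    (hs : ∀ j : Fin m, (α j.succ).1 ≤ (α j.castSucc).1 + 1) : FaceSum f α (Fin.last n) x := by
  refine faceSum_of_close f α (Fin.last n) x (f.down (Fin.zero_le (α 0)) ≫ f.close)
    (f.down (Fin.le_last (α (Fin.last m)))) ?_ (fun y => ?_) fun y j => ?_
  · exact (f.close_pull α).trans (Category.assoc _ _ _).symm
  · have h1 := entries_down f y (Fin.le_last (α (Fin.last m))) hl
    have h2 := entries_down_close f y (Fin.zero_le (α 0)) h0
    refine Eq.trans ?_ (congrArg₂ (fun a b => a ≫ b) h2 h1)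
    exact ((entries f y).close_pull α).trans (Category.assoc _ _ _).symm
  · exact entries_down f y _ (hs j)

lemma faceSum_inner (f : CyclicString N) (α : Fin (m + 1) →o Fin (n + 1)) (i : Fin (n + 1))
    (x : Fin (m + 1) → X) (h0 : α 0 = 0) (hl : α (Fin.last m) = Fin.last n) (j : Fin m)
    (h1 : α j.castSucc ≤ i) (h2 : i ≤ α j.succ) (h1' : i.1 ≤ (α j.castSucc).1 + 1)
    (h2' : (α j.succ).1 ≤ i.1 + 1)
    (hs : ∀ l : Fin m, l ≠ j → (α l.succ).1 ≤ (α l.castSucc).1 + 1) : FaceSum f α i x := by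
  refine faceSum_of_step f α i x j (f.down h2) (f.down h1) (f.down_down h1 h2).symm
    (fun y => ?_) (fun y => ?_) fun y l hlj => ?_
  · refine Eq.trans ?_ (congrArg₂ (fun a b => a ≫ b) (entries_down f y h2 h2')
      (entries_down f y h1 h1'))
    exact ((entries f y).down_down h1 h2).symm
  · have h := entries_close_down f y (Fin.le_last (α (Fin.last m))) hl
    refine Eq.trans ?_ (entries_down_zero f y h0 _)
    exact congrArg (fun b => (entries f y).down (Fin.zero_le (α 0)) ≫ b) h
  · exact entries_down f y _ (hs l hlj)

/-- Omitting the point `x_i` corresponds to composing `f i` with `f (i + 1)`: the matrix entry of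
a composite is a finite sum over the possible values of the omitted point. -/
lemma faceSum_face {N : Fin (n + 2) → ControlledObject k X} (f : CyclicString N)
    (i : Fin (n + 2)) (α : Fin (n + 1) →o Fin (n + 2)) (hα : ∀ j, α j = i.succAbove j)
    (x : Fin (n + 1) → X) : FaceSum f α i x := by
  have hval : ∀ j, (α j).1 = if j.1 < i.1 then j.1 else j.1 + 1 := fun j => by
    rw [hα, Fin.succAbove]
    simp only [Fin.lt_def, Fin.val_castSucc]
    split_ifs <;> simp
  have hlast : ((Fin.last n : Fin (n + 1)) : ℕ) = n := rfl
  have hzero : ((0 : Fin (n + 1)) : ℕ) = 0 := rfl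
  rcases Nat.eq_zero_or_pos i.1 with hi | hi
  · obtain rfl : i = 0 := Fin.ext hi
    refine faceSum_first f α x ?_ (Fin.ext ?_) fun j => ?_
    · rw [hval]; split_ifs <;> omega
    · rw [hval, if_neg (by omega)]; rfl
    · rw [hval, hval, if_neg (by omega), if_neg (by omega)]; exact le_rfl
  have h0 : α 0 = 0 := Fin.ext (by rw [hval, if_pos (by omega)]; rfl)
  rcases Nat.lt_or_ge i.1 (n + 1) with hi' | hi'
  · refine faceSum_inner f α i x h0 (Fin.ext ?_) ⟨i.1 - 1, by omega⟩ (Fin.le_def.2 ?_)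
      (Fin.le_def.2 ?_) ?_ ?_ fun l hl => ?_
    · rw [hval, if_neg (by omega)]; rfl
    · rw [hval]; simp only [Fin.castSucc_mk]; split_ifs <;> omega
    · rw [hval]; simp only [Fin.succ_mk]; split_ifs <;> omega
    · rw [hval]; simp only [Fin.castSucc_mk]; split_ifs <;> omega
    · rw [hval]; simp only [Fin.succ_mk]; split_ifs <;> omega
    · have : l.1 ≠ i.1 - 1 := fun h => hl (Fin.ext h)
      rw [hval, hval]
      simp only [Fin.val_succ, Fin.val_castSucc]
      split_ifs <;> omega
  · obtain rfl : i = Fin.last (n + 1) := Fin.ext (by have := i.2; simp only [Fin.val_last]; omega)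
    refine faceSum_last f α x h0 ?_ fun j => ?_
    · rw [hval]; split_ifs <;> omega
    · have := j.2
      rw [hval, hval]
      simp only [Fin.val_succ, Fin.val_castSucc, Fin.val_last]
      split_ifs <;> omega

/-- `φ` is compatible with the face maps. -/
lemma phi_face (i : Fin (n + 2)) (α : Fin (n + 1) →o Fin (n + 2))
    (hα : ∀ j, α j = i.succAbove j) (c : CyclicNerveModule k (ControlledObject k X) (n + 1)) :
    phi k X n (CyclicNerveModule.map α c) = coarseChains.push α (phi k X (n + 1) c) := by
  classical
  refine LinearMap.congr_fun (f := phi k X n ∘ₗ CyclicNerveModule.map α)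
    (g := coarseChains.push α ∘ₗ phi k X (n + 1)) (CyclicNerveModule.hom_ext fun N f => ?_) c
  refine Subtype.ext (funext fun x => ?_)
  rw [LinearMap.comp_apply, LinearMap.comp_apply, CyclicNerveModule.map_tmul, phi_tmul]
  obtain ⟨T, F, hF, hs, hT⟩ := faceSum_face f i α hα x
  have hins : ∀ z, (i.insertNth z x : Fin (n + 2) → X) ∘ α = x := fun z => funext fun a => by
    rw [Function.comp_apply, hα, Fin.insertNth_apply_succAbove]
  have hins' : ∀ y : Fin (n + 2) → X, y ∘ α = x → y = i.insertNth (y i) x := fun y h => by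
    subst h
    refine Fin.eq_insertNth_iff.2 ⟨rfl, funext fun a => ?_⟩
    rw [Function.comp_apply, hα]
    rfl
  change _ = coarseChains.pushFun α (phi k X (n + 1) (CyclicNerveModule.tmul k N f)).1 x
  rw [coarseChains.pushFun_eq α _ x (F.image fun z => i.insertNth z x), Finset.filter_true_of_mem,
    Finset.sum_image]
  · rw [hs]
    refine Finset.sum_congr rfl fun z _ => ?_
    rw [phi_tmul, hT _ (hins z), Fin.insertNth_apply_same]
  · intro z _ w _ h
    have := congrFun h i
    simpa only [Fin.insertNth_apply_same] using this
  · intro y hy'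
    obtain ⟨z, -, rfl⟩ := Finset.mem_image.1 hy'
    exact hins z
  · intro y hy0 hyx
    rw [phi_tmul, hT y hyx] at hy0
    refine Finset.mem_image.2 ⟨y i, ?_, (hins' y hyx).symm⟩
    by_contra hn
    exact hy0 (hF _ hn)

end Phi

section ChainMap

open AlgebraicTopology

/-- A family of maps between simplicial objects which commute with the face maps induces a map of
alternating face map complexes. -/
def chainMapOfFaces {C : Type*} [Category C] [Preadditive C] {A B : SimplicialObject C}
    (f : ∀ Δ, A.obj Δ ⟶ B.obj Δ)
    (hf : ∀ (n : ℕ) (i : Fin (n + 2)), f _ ≫ B.δ i = A.δ i ≫ f _) :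
    (alternatingFaceMapComplex C).obj A ⟶ (alternatingFaceMapComplex C).obj B :=
  ChainComplex.ofHom (X := (alternatingFaceMapComplex C).obj A)
    (Y := (alternatingFaceMapComplex C).obj B) (fun n => f _) fun n => by
    rw [alternatingFaceMapComplex_obj_d, alternatingFaceMapComplex_obj_d,
      AlternatingFaceMapComplex.objD, AlternatingFaceMapComplex.objD,
      Preadditive.comp_sum, Preadditive.sum_comp]
    refine Finset.sum_congr rfl fun i _ => ?_
    rw [Preadditive.comp_zsmul, Preadditive.zsmul_comp, hf]

variable (k : Type u) [Field k] (X : Type u) [BornCoarse X]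

/-- The map `φ` as a morphism of modules. -/
def phiHom (Δ : SimplexCategoryᵒᵖ) :
    (cyclicNerve k (ControlledObject k X)).obj Δ ⟶ (coarseChainsSimplicial k X).obj Δ :=
  ModuleCat.ofHom (ULift.moduleEquiv.symm.toLinearMap ∘ₗ phi k X Δ.unop.len)

lemma phiHom_naturality {Δ Δ' : SimplexCategoryᵒᵖ} (α : Δ ⟶ Δ')
    (h : ∀ c, phi k X _ (CyclicNerveModule.map α.unop.toOrderHom c) =
      coarseChains.push α.unop.toOrderHom (phi k X _ c)) :
    phiHom k X Δ ≫ (coarseChainsSimplicial k X).map α =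
      (cyclicNerve k (ControlledObject k X)).map α ≫ phiHom k X Δ' := by
  unfold phiHom cyclicNerve coarseChainsSimplicial
  rw [← ModuleCat.ofHom_comp, ← ModuleCat.ofHom_comp]
  exact congrArg ModuleCat.ofHom (LinearMap.ext fun c => congrArg ULift.up (h c).symm)

lemma phi_face_val {a b : ℕ} (hab : a = b + 1) (i : ℕ) (hi : i < a + 1)
    (α : Fin (b + 1) →o Fin (a + 1)) (hα : ∀ j, (α j).1 = if j.1 < i then j.1 else j.1 + 1)
    (c : CyclicNerveModule k (ControlledObject k X) a) :
    phi k X b (CyclicNerveModule.map α c) = coarseChains.push α (phi k X a c) := by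
  subst hab
  refine phi_face ⟨i, hi⟩ α (fun j => Fin.ext ?_) c
  rw [hα, Fin.succAbove]
  simp only [Fin.lt_def, Fin.val_castSucc]
  split_ifs <;> simp

lemma phiHom_face_aux {Δ Δ' : SimplexCategoryᵒᵖ} (α : Δ ⟶ Δ')
    (hab : Δ.unop.len = Δ'.unop.len + 1) (i : ℕ) (hi : i < Δ.unop.len + 1)
    (hα : ∀ j, (α.unop.toOrderHom j).1 = if j.1 < i then j.1 else j.1 + 1) :
    phiHom k X Δ ≫ (coarseChainsSimplicial k X).map α =
      (cyclicNerve k (ControlledObject k X)).map α ≫ phiHom k X Δ' :=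
  phiHom_naturality k X α (phi_face_val k X hab i hi _ hα)

lemma phiHom_face (n : ℕ) (i : Fin (n + 2)) :
    phiHom k X _ ≫ (coarseChainsSimplicial k X).δ i =
      (cyclicNerve k (ControlledObject k X)).δ i ≫ phiHom k X _ :=
  phiHom_face_aux k X (SimplexCategory.δ i).op rfl i.1 i.2 fun j => by
    change (i.succAbove j).1 = _
    rw [Fin.succAbove]
    simp only [Fin.lt_def, Fin.val_castSucc]
    split_ifs <;> simp

/-- The chain map `φ` from the Hochschild complex of the category of `X`-controlled
finite-dimensional vector spaces to the complex of locally finite controlled chains; it represents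
the transformation from coarse Hochschild homology to coarse ordinary homology. -/
def phiChainMap : hochschildComplex k (ControlledObject k X) ⟶ coarseChainComplex k X :=
  chainMapOfFaces (phiHom k X) (phiHom_face k X)

end ChainMap

end CoarseHH

end

/-! Over a point both complexes are resolutions of the field. Each is the alternating face map
complex of a simplicial module augmented over `k`, and each augmentation admits an extra degeneracy,
hence is a homotopy equivalence onto `k` in degree zero. The nerve is augmented by the trace of the
cyclic composite, which is the only coefficient of the chain that `phi` produces; so `phi` commutes
with the augmentations (`phiChainMap_comp_augmentation`), and two out of three finishes the proof.

On the side of chains, `X ^ (n + 1)` is a single point and all structure maps preserve the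
coefficient, so every identity required of an extra degeneracy holds automatically.

For the nerve, the value at the point identifies controlled objects with finite-dimensional vector
spaces: `entry` at the point is multiplicative and bijective on morphisms. Let `e` be the line, and
choose for each object `M` basis vectors `inc i : e ⟶ M` with coordinates `ret i : M ⟶ e`, so that
`∑ i, ret i ≫ inc i = 𝟙 M`. The contraction splits the closing entry at `e`: `f 0 ⊗ ⋯ ⊗ f n ↦ ∑ i,
(inc i ≫ f 0) ⊗ ret i ⊗ f 1 ⊗ ⋯ ⊗ f n`. The zeroth face recomposes `f 0`. Compatibility with the
other structure maps requires moving the element `∑ i, inc i ⊗ ret i` along morphisms between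
objects; this is `sum_bilin_naturality`, which rests on the endomorphisms of `e` being scalars. In
degree zero the remaining face yields the endomorphism `∑ i, inc i ≫ f ≫ ret i` of `e`, which is
multiplication by the trace of `f` (`sum_inc_comp_ret`). Hence the augmentation has to be the trace.
-/

noncomputable section

namespace CoarseHH

/-! ### Cyclic strings with an adjoined vertex -/

section Cone

/-- The extension of a monotone map by `0 ↦ 0`. -/
def coneMap {m n : ℕ} (α : Fin (m + 1) →o Fin (n + 1)) : Fin (m + 1 + 1) →o Fin (n + 1 + 1) where
  toFun := Fin.cases 0 fun j => (α j).succ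
  monotone' := by
    intro i j
    refine Fin.cases (fun _ => Fin.zero_le _) (fun i => ?_) i
    refine Fin.cases (fun h => absurd h (not_le.2 (Fin.succ_pos i))) (fun j h => ?_) j
    exact Fin.succ_le_succ_iff.2 (α.monotone (Fin.succ_le_succ_iff.1 h))

variable {V : Type*} [Category V]

/-- The tuple `(e, N 0, …, N n)`. -/
def coneObj {n : ℕ} (e : V) (N : Fin (n + 1) → V) : Fin (n + 1 + 1) → V := Fin.cases e N

namespace CyclicString

variable {m n : ℕ} {N : Fin (n + 1) → V} {e : V}

/-- The cyclic string on `(e, N 0, …, N n)` whose closing entry is `p`, whose first step is `q` and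
whose other steps are those of `f`. -/
def cone (f : CyclicString N) (p : e ⟶ N (Fin.last n)) (q : N 0 ⟶ e) :
    CyclicString (coneObj e N) :=
  ofClose (N := coneObj e N) p
    (Fin.cases (motive := fun i => coneObj e N i.succ ⟶ coneObj e N i.castSucc) q
      fun i => f.step i)

/-- Only the closing entry and the first step of the cone touch `e`; composites between shifted
indices never meet them. -/
lemma cone_down_succ (f : CyclicString N) (p : e ⟶ N (Fin.last n)) (q : N 0 ⟶ e)
    {i j : Fin (n + 1)} (h : i ≤ j) (h' : i.succ ≤ j.succ) :
    (f.cone p q).down h' = f.down h := by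
  induction j using Fin.induction with
  | zero =>
    obtain rfl : i = 0 := le_antisymm h (Fin.zero_le _)
    rw [down_self, down_self]
    rfl
  | succ j ih =>
    rcases h.eq_or_lt with rfl | hlt
    · rw [down_self, down_self]
      rfl
    · have h1 : i ≤ j.castSucc := Fin.le_castSucc_iff.2 hlt
      have h2 : i.succ ≤ j.succ.castSucc := Fin.succ_le_succ_iff.2 h1
      rw [down_succ f h1, down_succ (f.cone p q) h2, ← ih h1 (Fin.succ_le_succ_iff.2 h1)]
      rfl

lemma cone_down_zero (f : CyclicString N) (p : e ⟶ N (Fin.last n)) (q : N 0 ⟶ e)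
    (j : Fin (n + 1)) (h : 0 ≤ j.succ) :
    (f.cone p q).down h = f.down (Fin.zero_le j) ≫ q := by
  rw [← cone_down_succ f p q (Fin.zero_le j) (Fin.succ_le_succ_iff.2 (Fin.zero_le j))]
  have h1 : (0 : Fin (n + 1 + 1)) ≤ (0 : Fin (n + 1)).succ := Fin.zero_le _
  have h2 : (f.cone p q).down h1 = q := (f.cone p q).down_step 0 h1
  rw [← down_down (f.cone p q) h1 (Fin.succ_le_succ_iff.2 (Fin.zero_le j)), h2]
  rfl

/-- The vertex `e` is kept, so the parts of `f` before `α 0` and after `α (Fin.last m)`, which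
`pull` would merge through the closing entry of `f`, now split: the first is absorbed by `q`, the
second by `p`. The equality is heterogeneous because the object tuples on the two sides agree
definitionally only at each concrete index. -/
lemma pull_cone (f : CyclicString N) (p : e ⟶ N (Fin.last n)) (q : N 0 ⟶ e)
    (α : Fin (m + 1) →o Fin (n + 1)) (i : Fin (m + 2)) :
    HEq ((f.cone p q).pull (coneMap α) i)
      ((f.pull α).cone (p ≫ f.down (Fin.le_last (α (Fin.last m))))
        (f.down (Fin.zero_le (α 0)) ≫ q) i) := by
  refine Fin.cases (heq_of_eq ?_) (fun i => ?_) i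
  · refine (close_pull (f.cone p q) (coneMap α)).trans ?_
    have h1 : (f.cone p q).down (Fin.zero_le (coneMap α 0)) = 𝟙 e := down_self _ _
    have h2 : (f.cone p q).down (Fin.le_last (coneMap α (Fin.last (m + 1)))) =
      f.down (Fin.le_last (α (Fin.last m))) :=
      cone_down_succ f p q (Fin.le_last (α (Fin.last m))) _
    rw [h1, h2]
    exact Category.id_comp _
  · refine Fin.cases (heq_of_eq ?_) (fun i => heq_of_eq ?_) i
    · exact cone_down_zero f p q (α 0) _
    · exact cone_down_succ f p q _ _

end CyclicString

end Cone

/-! ### Elementary tensors of cones and their faces -/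

section ConeModule

variable {k : Type u} [Field k] {V : Type*} [Category V] [Preadditive V] [Linear k V]
variable {m n : ℕ}

namespace CyclicNerveModule

/-- Object tuples that agree only index by index live in different summands as far as types are
concerned; comparing entries by `HEq` allows a check at each index, where the types coincide. -/
lemma tmul_congr {N N' : Fin (n + 1) → V} {f : CyclicString N} {f' : CyclicString N'}
    (h : ∀ i, N i = N' i) (hf : ∀ i, HEq (f i) (f' i)) : tmul k N f = tmul k N' f' := by
  obtain rfl : N = N' := funext h
  obtain rfl : f = f' := funext fun i => eq_of_heq (hf i)
  rfl

/-- The elementary tensor of a cyclic string, as a linear function of one entry. -/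
def tmulUpdate {N : Fin (n + 1) → V} (f : CyclicString N) (i : Fin (n + 1)) :
    (N i ⟶ N (cpred i)) →ₗ[k] CyclicNerveModule k V n where
  toFun v := tmul k N (Function.update f i v)
  map_add' v w := by rw [tmul, tmul, tmul, MultilinearMap.map_update_add, map_add]
  map_smul' c v := by
    rw [tmul, tmul, MultilinearMap.map_update_smul, map_smul]
    rfl

lemma tmul_eq_tmulUpdate {N : Fin (n + 1) → V} (f g : CyclicString N) (i : Fin (n + 1))
    (h : ∀ j, j ≠ i → g j = f j) : tmul k N g = tmulUpdate f i (g i) :=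
  congrArg (tmul k N) (Function.eq_update_iff.2 ⟨rfl, h⟩)

/-- The elementary tensor of a cyclic string, as a linear function of the closing entry. -/
def tmulClose (N : Fin (n + 1) → V) (s : ∀ i : Fin n, N i.succ ⟶ N i.castSucc) :
    (N 0 ⟶ N (Fin.last n)) →ₗ[k] CyclicNerveModule k V n :=
  -- The closing entry is entry `0`, so linearity in it is linearity of an update at `0`; the value
  -- it has in the base string is irrelevant.
  have h : ∀ c, tmul k N (CyclicString.ofClose c s) = tmulUpdate (CyclicString.ofClose 0 s) 0 c :=
    fun _ => tmul_eq_tmulUpdate _ _ 0 (Fin.cases (fun h => absurd rfl h) fun _ _ => rfl)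
  { toFun := fun c => tmul k N (CyclicString.ofClose c s)
    map_add' := fun a b => by
      rw [h, h, h]
      exact map_add (tmulUpdate (CyclicString.ofClose 0 s) 0) a b
    map_smul' := fun r a => by
      rw [h, h]
      exact map_smul (tmulUpdate (CyclicString.ofClose 0 s) 0) r a }

variable (k) in
lemma tmul_eq_tmulClose (N : Fin (n + 1) → V) (f : CyclicString N) :
    tmul k N f = tmulClose N f.step f.close :=
  congrArg (tmul k N) (CyclicString.ext' rfl fun _ => rfl)

/-- The elementary tensor of `f.cone p q`, as a bilinear function of `p` and `q`. -/
def tmulCone {N : Fin (n + 1) → V} (e : V) (f : CyclicString N) :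
    (e ⟶ N (Fin.last n)) →ₗ[k] (N 0 ⟶ e) →ₗ[k] CyclicNerveModule k V (n + 1) :=
  have h0 : ∀ p q, tmul k (coneObj e N) (f.cone p q) = tmulUpdate (f.cone 0 q) 0 p :=
    fun _ _ => tmul_eq_tmulUpdate _ _ 0 (Fin.cases (fun h => absurd rfl h) fun _ _ => rfl)
  -- `q` is the arrow into `e`, the object with index `0`, hence the entry with index `1`.
  have h1 : ∀ p q, tmul k (coneObj e N) (f.cone p q) = tmulUpdate (f.cone p 0) 1 q :=
    fun _ _ => tmul_eq_tmulUpdate _ _ 1 (Fin.cases (fun _ => rfl)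
      (Fin.cases (fun h => absurd rfl h) fun _ _ => rfl))
  LinearMap.mk₂ k (fun p q => tmul k (coneObj e N) (f.cone p q))
    (fun p p' q => by
      rw [h0, h0, h0]
      exact map_add (tmulUpdate (f.cone 0 q) 0) p p')
    (fun c p q => by
      rw [h0, h0]
      exact map_smul (tmulUpdate (f.cone 0 q) 0) c p)
    (fun p q q' => by
      rw [h1, h1, h1]
      exact map_add (tmulUpdate (f.cone p 0) 1) q q')
    (fun c p q => by
      rw [h1, h1]
      exact map_smul (tmulUpdate (f.cone p 0) 1) c q)

lemma tmulCone_apply {N : Fin (n + 1) → V} {e : V} (f : CyclicString N)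
    (p : e ⟶ N (Fin.last n)) (q : N 0 ⟶ e) :
    tmulCone e f p q = tmul k (coneObj e N) (f.cone p q) := rfl

lemma map_coneMap_tmulCone {N : Fin (n + 1) → V} {e : V} (f : CyclicString N)
    (p : e ⟶ N (Fin.last n)) (q : N 0 ⟶ e) (α : Fin (m + 1) →o Fin (n + 1)) :
    map (coneMap α) (tmulCone (k := k) e f p q) =
      tmulCone e (f.pull α) (p ≫ f.down (Fin.le_last (α (Fin.last m))))
        (f.down (Fin.zero_le (α 0)) ≫ q) := by
  rw [tmulCone_apply, map_tmul, tmulCone_apply]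
  exact tmul_congr (Fin.cases rfl fun _ => rfl) (f.pull_cone p q α)

/-- Omitting `e` fuses the two arrows at `e` into a closing entry `N 0 ⟶ N n`. This is the face that
inverts the extra degeneracy. -/
lemma map_succ_tmulCone {N : Fin (n + 1) → V} {e : V} (f : CyclicString N)
    (p : e ⟶ N (Fin.last n)) (q : N 0 ⟶ e) (α : Fin (n + 1) →o Fin (n + 1 + 1))
    (hα : ∀ j, α j = j.succ) :
    map α (tmulCone (k := k) e f p q) = tmulClose N f.step (q ≫ p) := by
  obtain rfl : α = ⟨Fin.succ, fun _ _ h => Fin.succ_le_succ_iff.2 h⟩ := OrderHom.ext _ _ (funext hα)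
  rw [tmulCone_apply, map_tmul]
  refine tmul_congr (fun _ => rfl) (Fin.cases (heq_of_eq ?_) fun i => heq_of_eq ?_)
  · refine (CyclicString.close_pull (f.cone p q) _).trans ?_
    have h1 : (f.cone p q).down (Fin.zero_le (0 : Fin (n + 1)).succ) = q :=
      (f.cone_down_zero p q 0 _).trans (by rw [CyclicString.down_self, Category.id_comp])
    have h2 : (f.cone p q).down (Fin.le_last (Fin.last n).succ) = 𝟙 (N (Fin.last n)) :=
      CyclicString.down_self _ _
    refine (congrArg₂ (fun a b => a ≫ p ≫ b) h1 h2).trans ?_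
    exact congrArg (fun t => q ≫ t) (Category.comp_id p)
  · refine (f.cone_down_succ p q (Fin.castSucc_le_succ i) _).trans ?_
    exact f.down_step i _

/-- This is the face which omits `N 0` and leaves a loop at `e`. The loop does not involve `f`: a
cone keeps only the steps of `f`, and in degree zero there are none. -/
lemma map_zero_tmulCone {N : Fin (0 + 1) → V} {e : V} (f : CyclicString N)
    (p : e ⟶ N (Fin.last 0)) (q : N 0 ⟶ e) (α : Fin (0 + 1) →o Fin (0 + 1 + 1))
    (hα : ∀ j, α j = 0) :
    map α (tmulCone (k := k) e f p q) =
      tmulClose (fun _ : Fin 1 => e) (fun i => i.elim0) (p ≫ q) := by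
  obtain rfl : α = ⟨fun _ => 0, fun _ _ _ => le_rfl⟩ := OrderHom.ext _ _ (funext hα)
  rw [tmulCone_apply, map_tmul]
  refine tmul_congr (fun _ => rfl) (Fin.cases (heq_of_eq ?_) fun i => i.elim0)
  refine (CyclicString.close_pull (f.cone p q) _).trans ?_
  have h1 : (f.cone p q).down (Fin.zero_le (0 : Fin (0 + 1 + 1))) = 𝟙 e :=
    CyclicString.down_self _ _
  have h2 : (f.cone p q).down (Fin.le_last (0 : Fin (0 + 1 + 1))) = q :=
    (f.cone_down_zero p q 0 _).trans (by rw [CyclicString.down_self, Category.id_comp])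
  refine (congrArg₂ (fun a b => a ≫ p ≫ b) h1 h2).trans ?_
  exact Category.id_comp _

end CyclicNerveModule

end ConeModule

/-! ### The contraction defined by a scalar generator -/

section ScalarGenerator

/-- An object `e` of a `k`-linear category, all of whose endomorphisms are scalars, such that the
identity of every object is a finite sum of morphisms which factor through `e`. -/
structure ScalarGenerator (k : Type u) [Field k] (V : Type*) [Category V] [Preadditive V]
    [Linear k V] where
  /-- The generating object. -/
  e : V
  /-- The number of summands needed for the identity of an object. -/
  rank : V → ℕ
  /-- The morphisms out of the generating object. -/
  inc : ∀ M, Fin (rank M) → (e ⟶ M)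
  /-- The morphisms into the generating object. -/
  ret : ∀ M, Fin (rank M) → (M ⟶ e)
  sum_ret_inc : ∀ M, ∑ i, ret M i ≫ inc M i = 𝟙 M
  exists_smul_id : ∀ g : e ⟶ e, ∃ c : k, g = c • 𝟙 e

namespace ScalarGenerator

variable {k : Type u} [Field k] {V : Type*} [Category V] [Preadditive V] [Linear k V]
variable {m n : ℕ} (S : ScalarGenerator k V)

open CyclicNerveModule

/-- This gives multilinearity of the extra degeneracy. The cone forgets the closing entry of `f`,
which enters once, through `u ≫ f.close`; every step of `f` enters once, as a step of the cone. -/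
lemma exists_tmulCone_update [DecidableEq (Fin (n + 1))] {N : Fin (n + 1) → V}
    (f : CyclicString N) {e : V} (u : e ⟶ N 0) (v : N 0 ⟶ e) (a : Fin (n + 1)) :
    ∃ L : (N a ⟶ N (cpred a)) →ₗ[k] CyclicNerveModule k V (n + 1), ∀ x,
      tmulCone e (Function.update f a x)
        (u ≫ CyclicString.close (Function.update f a x)) v = L x := by
  revert a
  refine Fin.cases ?_ fun a => ?_
  · refine ⟨(tmulCone e f).flip v ∘ₗ Linear.leftComp k (N (Fin.last n)) u, fun x => ?_⟩
    have h1 : CyclicString.close (Function.update f 0 x) = x := Function.update_self _ _ _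
    rw [h1]
    refine congrArg (tmul k (coneObj e N)) (CyclicString.ext' rfl (Fin.cases rfl fun i => ?_))
    exact Function.update_of_ne (Fin.succ_ne_zero i) _ _
  -- Adjoining `e` in front shifts the indices of the steps by one.
  · refine ⟨tmulUpdate (f.cone (u ≫ f.close) v) a.succ.succ, fun x => ?_⟩
    have h1 : CyclicString.close (Function.update f a.succ x) = f.close :=
      Function.update_of_ne (Fin.succ_ne_zero a).symm _ _
    rw [h1, tmulCone_apply]
    refine (tmul_eq_tmulUpdate (f.cone (u ≫ f.close) v) _ a.succ.succ ?_).trans ?_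
    · refine Fin.cases (fun _ => rfl) (Fin.cases (fun _ => rfl) fun j hj => ?_)
      exact Function.update_of_ne (fun h => hj (congrArg Fin.succ h)) _ _
    · exact congrArg (tmulUpdate (f.cone (u ≫ f.close) v) a.succ.succ)
        (Function.update_self (β := fun i => N i ⟶ N (cpred i)) a.succ x f)

/-- The extra degeneracy of the additive cyclic nerve:
`f 0 ⊗ ⋯ ⊗ f n ↦ ∑ i, (inc i ≫ f 0) ⊗ ret i ⊗ f 1 ⊗ ⋯ ⊗ f n`. -/
def extraDegeneracyMap (n : ℕ) : CyclicNerveModule k V n →ₗ[k] CyclicNerveModule k V (n + 1) :=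
  lift fun N => ∑ i : Fin (S.rank (N 0)),
    { toFun := fun f => tmulCone S.e f (S.inc (N 0) i ≫ CyclicString.close f) (S.ret (N 0) i)
      map_update_add' := fun f a x y => by
        obtain ⟨L, hL⟩ := exists_tmulCone_update (k := k) f (S.inc (N 0) i) (S.ret (N 0) i) a
        rw [hL, hL, hL, map_add]
      map_update_smul' := fun f a c x => by
        obtain ⟨L, hL⟩ := exists_tmulCone_update (k := k) f (S.inc (N 0) i) (S.ret (N 0) i) a
        rw [hL, hL, map_smul] }

lemma extraDegeneracyMap_tmul (N : Fin (n + 1) → V) (f : CyclicString N) :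
    S.extraDegeneracyMap n (tmul k N f) =
      ∑ i, tmulCone S.e f (S.inc (N 0) i ≫ f.close) (S.ret (N 0) i) := by
  rw [extraDegeneracyMap, lift_tmul, sum_apply]
  rfl

/-- The canonical element `∑ i, inc i ⊗ ret i` is natural. -/
lemma sum_bilin_naturality {W : Type*} [AddCommGroup W] [Module k W] {M M' : V} (d : M ⟶ M')
    (B : (S.e ⟶ M') →ₗ[k] (M ⟶ S.e) →ₗ[k] W) :
    ∑ i, B (S.inc M' i) (d ≫ S.ret M' i) = ∑ j, B (S.inc M j ≫ d) (S.ret M j) := by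
  -- The scalars `c i j` form the matrix of `d` with respect to the chosen generators. Both sides
  -- expand to `∑ c i j • B (inc i) (ret j)`, with `inc` taken for `M'` and `ret` for `M`.
  choose c hc using fun i j => S.exists_smul_id (S.inc M j ≫ d ≫ S.ret M' i)
  have h1 : ∀ i, d ≫ S.ret M' i = ∑ j, c i j • S.ret M j := fun i => by
    rw [← Category.id_comp (d ≫ S.ret M' i), ← S.sum_ret_inc M, Preadditive.sum_comp]
    refine Finset.sum_congr rfl fun j _ => ?_
    rw [Category.assoc, hc, Linear.comp_smul, Category.comp_id]
  have h2 : ∀ j, S.inc M j ≫ d = ∑ i, c i j • S.inc M' i := fun j => by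
    rw [← Category.comp_id (S.inc M j ≫ d), ← S.sum_ret_inc M', Preadditive.comp_sum]
    refine Finset.sum_congr rfl fun i _ => ?_
    rw [← Category.assoc, Category.assoc (S.inc M j), hc, Linear.smul_comp, Category.id_comp]
  simp only [h1, h2, map_sum, map_smul, LinearMap.sum_apply, LinearMap.smul_apply]
  exact Finset.sum_comm

/-- Pulling back first uses the generators of `N (α 0)`, contracting first those of `N 0`.
Naturality of the canonical element along `f.down : N (α 0) ⟶ N 0` exchanges them. -/
lemma map_coneMap_extraDegeneracyMap (α : Fin (m + 1) →o Fin (n + 1)) :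
    map (coneMap α) ∘ₗ S.extraDegeneracyMap n = S.extraDegeneracyMap m ∘ₗ map α := by
  refine hom_ext fun N f => ?_
  rw [LinearMap.comp_apply, LinearMap.comp_apply, extraDegeneracyMap_tmul, map_tmul,
    extraDegeneracyMap_tmul, map_sum]
  simp only [map_coneMap_tmulCone]
  have h := S.sum_bilin_naturality (f.down (Fin.zero_le (α 0)))
    (tmulCone (k := k) S.e (f.pull α) ∘ₗ
      Linear.rightComp k S.e (f.close ≫ f.down (Fin.le_last (α (Fin.last m)))))
  refine Eq.trans (Finset.sum_congr rfl fun i _ => ?_) (h.trans (Finset.sum_congr rfl fun j _ => ?_))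
  · rw [Category.assoc]
    rfl
  · rw [CyclicString.close_pull, ← Category.assoc]
    rfl

/-- Stated through the values of `β` so that it applies to `δ i.succ` and `σ i.succ`, which extend
`δ i` and `σ i` by `0 ↦ 0`. -/
lemma map_extraDegeneracyMap (α : Fin (m + 1) →o Fin (n + 1))
    (β : Fin (m + 1 + 1) →o Fin (n + 1 + 1)) (h0 : β 0 = 0)
    (h : ∀ j, β j.succ = (α j).succ) (c : CyclicNerveModule k V n) :
    map β (S.extraDegeneracyMap n c) = S.extraDegeneracyMap m (map α c) := by
  obtain rfl : β = coneMap α := OrderHom.ext _ _ (funext (Fin.cases h0 h))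
  exact LinearMap.congr_fun (S.map_coneMap_extraDegeneracyMap α) c

/-- After omitting `e` the closing entries are `ret i ≫ inc i ≫ f.close`, and these sum to `f.close`
by the partition of the identity. -/
lemma map_succ_extraDegeneracyMap (α : Fin (n + 1) →o Fin (n + 1 + 1)) (hα : ∀ j, α j = j.succ)
    (c : CyclicNerveModule k V n) : map α (S.extraDegeneracyMap n c) = c := by
  refine LinearMap.congr_fun (f := map α ∘ₗ S.extraDegeneracyMap n) (g := LinearMap.id)
    (hom_ext fun N f => ?_) c
  rw [LinearMap.comp_apply, extraDegeneracyMap_tmul, map_sum, LinearMap.id_apply,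
    tmul_eq_tmulClose k N f]
  have h : f.close = ∑ i, S.ret (N 0) i ≫ S.inc (N 0) i ≫ f.close := by
    simp_rw [← Category.assoc]
    rw [← Preadditive.sum_comp, S.sum_ret_inc, Category.id_comp]
  refine Eq.trans ?_ ((congrArg (tmulClose N f.step) h).trans (map_sum _ _ _)).symm
  refine Finset.sum_congr rfl fun i _ => ?_
  rw [map_succ_tmulCone _ _ _ _ hα]

lemma map_zero_extraDegeneracyMap_tmul (α : Fin (0 + 1) →o Fin (0 + 1 + 1)) (hα : ∀ j, α j = 0)
    (N : Fin (0 + 1) → V) (f : CyclicString N) :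
    map α (S.extraDegeneracyMap 0 (tmul k N f)) =
      tmulClose (fun _ : Fin 1 => S.e) (fun i => i.elim0)
        (∑ i, S.inc (N 0) i ≫ f.close ≫ S.ret (N 0) i) := by
  rw [extraDegeneracyMap_tmul, map_sum, map_sum]
  refine Finset.sum_congr rfl fun i _ => ?_
  rw [map_zero_tmulCone _ _ _ _ hα, Category.assoc]

/-- The class of scalars in the additive cyclic nerve in degree zero. -/
def scalarClass : k →ₗ[k] CyclicNerveModule k V 0 :=
  LinearMap.toSpanSingleton k _
    (tmulClose (fun _ : Fin (0 + 1) => S.e) (fun i => i.elim0) (𝟙 S.e))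

/-- The hypothesis on `t` says that the loop left at `e` is `t` times the identity, so the composite
factors through the scalars. It is the identity linking the extra degeneracy in degree zero to the
augmentation. -/
lemma map_zero_extraDegeneracyMap (t : CyclicNerveModule k V 0 →ₗ[k] k)
    (ht : ∀ (N : Fin (0 + 1) → V) (f : CyclicString N),
      ∑ i, S.inc (N 0) i ≫ f.close ≫ S.ret (N 0) i = t (tmul k N f) • 𝟙 S.e)
    (α : Fin (0 + 1) →o Fin (0 + 1 + 1)) (hα : ∀ j, α j = 0) (c : CyclicNerveModule k V 0) :
    map α (S.extraDegeneracyMap 0 c) = S.scalarClass (t c) := by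
  refine LinearMap.congr_fun (f := map α ∘ₗ S.extraDegeneracyMap 0) (g := S.scalarClass ∘ₗ t)
    (hom_ext fun N f => ?_) c
  rw [LinearMap.comp_apply, LinearMap.comp_apply,
    map_zero_extraDegeneracyMap_tmul _ α hα, ht, map_smul]
  rfl

end ScalarGenerator

end ScalarGenerator

/-! ### The augmented cyclic nerve and its extra degeneracy -/

section Augmented

universe v w

variable {k : Type u} [Field k] {V : Type w} [Category.{v} V] [Preadditive V] [Linear k V]
variable (t : ∀ n, CyclicNerveModule k V n →ₗ[k] k)
  (ht : ∀ (m n : ℕ) (α : Fin (m + 1) →o Fin (n + 1)), t m ∘ₗ CyclicNerveModule.map α = t n)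

/-- The additive cyclic nerve, augmented by a compatible family of linear forms. -/
def cyclicNerveAugmented : SimplicialObject.Augmented (ModuleCat.{max w v u} k) where
  left := cyclicNerve k V
  right := ModuleCat.of k (ULift.{max w v u} k)
  hom :=
    { app := fun Δ => ModuleCat.ofHom (ULift.moduleEquiv.symm.toLinearMap ∘ₗ t Δ.unop.len)
      naturality := fun Δ Δ' α => by
        refine ModuleCat.hom_ext (LinearMap.ext fun c => congrArg ULift.up ?_)
        exact LinearMap.congr_fun (ht _ _ α.unop.toOrderHom) c }

/-- A scalar generator, whose diagonal coefficients sum up to the augmentation, yields an extra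
degeneracy of the augmented cyclic nerve. -/
def cyclicNerveExtraDegeneracy (S : ScalarGenerator k V) (h1 : ∀ c, t 0 (S.scalarClass c) = c)
    (hS : ∀ (N : Fin (0 + 1) → V) (f : CyclicString N),
      ∑ i, S.inc (N 0) i ≫ f.close ≫ S.ret (N 0) i =
        t 0 (CyclicNerveModule.tmul k N f) • 𝟙 S.e) :
    (cyclicNerveAugmented t ht).ExtraDegeneracy where
  s' := ModuleCat.ofHom (S.scalarClass ∘ₗ ULift.moduleEquiv.toLinearMap)
  s n := ModuleCat.ofHom (S.extraDegeneracyMap n)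
  s'_comp_ε := ModuleCat.hom_ext (LinearMap.ext fun c => congrArg ULift.up (h1 c.down))
  s₀_comp_δ₁ := ModuleCat.hom_ext (LinearMap.ext fun c =>
    S.map_zero_extraDegeneracyMap (t 0) hS (SimplexCategory.δ (n := 0) 1).toOrderHom
      -- The coface omitting `1` in `{0, 1}` is the constant map `0`.
      (fun j => by rw [Subsingleton.elim (α := Fin 1) j 0]; rfl) c)
  s_comp_δ₀ n := ModuleCat.hom_ext (LinearMap.ext fun c =>
    S.map_succ_extraDegeneracyMap (SimplexCategory.δ (n := n) 0).toOrderHom (fun _ => rfl) c)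
  s_comp_δ n i := ModuleCat.hom_ext (LinearMap.ext fun c =>
    S.map_extraDegeneracyMap (SimplexCategory.δ i).toOrderHom (SimplexCategory.δ i.succ).toOrderHom
      (Fin.succ_succAbove_zero i) (Fin.succ_succAbove_succ i) c)
  s_comp_σ n i := ModuleCat.hom_ext (LinearMap.ext fun c =>
    S.map_extraDegeneracyMap (SimplexCategory.σ i).toOrderHom (SimplexCategory.σ i.succ).toOrderHom
      rfl (Fin.succ_predAbove_succ i) c)

end Augmented

/-! ### Controlled vector spaces on a point -/

section OnePoint

variable {k : Type u} [Field k] {X : Type u} [BornCoarse X] [Unique X]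

lemma Bdd.eq_empty_or_eq_pt (B : Bdd X) : B = ∅ ∨ B = Bdd.pt default := by
  rcases Set.eq_empty_or_nonempty B.1 with h | ⟨x, hx⟩
  · exact Or.inl (Subtype.ext h)
  · obtain rfl : x = default := Subsingleton.elim _ _
    refine Or.inr (Subtype.ext (Set.eq_singleton_iff_unique_mem.2 ⟨hx, fun _ _ => ?_⟩))
    exact Subsingleton.elim _ _

namespace ControlledObject

lemma entry_comp_default {M N P : ControlledObject k X} (f : M ⟶ N) (g : N ⟶ P) :
    entry default default (f ≫ g) =
      entry (default : X) (default : X) f ≫ entry (default : X) (default : X) g := by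
  rw [entry_comp f g default default {default} fun y hy =>
    absurd (Finset.mem_singleton.2 (Subsingleton.elim _ _)) hy, Finset.sum_singleton]

/-- The projection is always a left inverse of the inclusion of the point; here it is a two-sided
one, since a bounded set containing the point equals the point. -/
lemma proj_comp_incl (M : ControlledObject k X) (B : Bdd X) (h : Bdd.pt default ≤ B) :
    M.proj B default ≫ M.incl h = 𝟙 _ := by
  rcases B.eq_empty_or_eq_pt with rfl | rfl
  · exact M.isZero_empty.eq_of_src _ _
  · have := M.incl_proj_self h
    rw [incl_self, Category.id_comp] at this
    rw [this, incl_self, Category.id_comp]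

/-- The component at `∅` has zero source. The component at the point is recovered from the entry,
because projecting to the point loses nothing on a one-point space. -/
lemma entry_default_injective (M N : ControlledObject k X) :
    Function.Injective (entry (M := M) (N := N) (default : X) (default : X)) := by
  refine (injective_iff_map_eq_zero _).2 fun f hf => ?_
  obtain ⟨U, a, rfl⟩ := Hom.exists_of f
  rw [entry_of] at hf
  refine (Hom.of_eq_of (b := (0 : Mor M N U)) U le_rfl le_rfl fun B => ?_).trans
    (map_zero (Hom.of U))
  refine congrArg (fun t => t ≫ _) (?_ : a.at B = 0)
  rcases B.eq_empty_or_eq_pt with rfl | rfl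
  · exact M.isZero_empty.eq_of_src _ _
  -- An entourage need not contain the diagonal, so the thickening of the point may be empty; the
  -- target is then zero.
  rcases (U.thick (Bdd.pt default)).eq_empty_or_eq_pt with h | h
  · exact IsZero.eq_of_tgt (by rw [h]; exact N.isZero_empty) _ _
  · have h1 := congrArg (fun t => t ≫ N.incl h.ge) hf
    simpa only [Category.assoc, proj_comp_incl, Category.comp_id, Limits.zero_comp] using h1

-- A linear map between the values at the point is realised with diagonal control: project to the
-- point, apply the map, include into the thickening. On `∅` zero is the only choice.
open scoped Classical in
lemma entry_default_surjective (M N : ControlledObject k X) :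
    Function.Surjective (entry (M := M) (N := N) (default : X) (default : X)) := by
  intro t
  have hne : ∀ {B : Bdd X}, Bdd.pt default ≤ B → Bdd.pt default ≤ Ent.diag.thick B :=
    fun h => h.trans (Ent.le_thick_diag _)
  let a : Mor M N Ent.diag :=
    { app := fun B => if h : Bdd.pt default ≤ B then M.proj B default ≫ t ≫ N.incl (hne h) else 0
      naturality := fun B C f => by
        rcases B.eq_empty_or_eq_pt with rfl | rfl
        · exact M.isZero_empty.eq_of_src _ _
        rw [dif_pos le_rfl, dif_pos (leOfHom f)]
        change M.incl (leOfHom f) ≫ _ = (_ ≫ _ ≫ N.incl _) ≫ N.incl _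
        rw [← Category.assoc, incl_proj]
        simp only [Category.assoc, incl_incl] }
  refine ⟨Hom.of _ a, ?_⟩
  have ha : a.at (Bdd.pt default) =
      M.proj (Bdd.pt default) default ≫ t ≫ N.incl (hne le_rfl) := dif_pos le_rfl
  have h1 := M.incl_proj_self (B := Bdd.pt (default : X)) le_rfl
  rw [incl_self, Category.id_comp] at h1
  rw [entry_of, ha, h1, Category.id_comp, Category.assoc, incl_proj_self, Category.comp_id]

end ControlledObject

/-- Any two bounded subsets of a point are nested, so two parallel sides of the square are
isomorphisms, and such a commutative square is a push-out for every functor. -/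
lemma Bdd.isPushout_map {C : Type*} [Category C] (F : Bdd X ⥤ C) (B B' : Bdd X) :
    IsPushout (F.map (homOfLE (B.inter_le_left B'))) (F.map (homOfLE (B.inter_le_right B')))
      (F.map (homOfLE (B.le_union_left B'))) (F.map (homOfLE (B.le_union_right B'))) := by
  have hiso : ∀ {P Q : Bdd X} (h : P ≤ Q), P = Q → IsIso (F.map (homOfLE h)) := fun h e => by
    subst e
    exact inferInstanceAs (IsIso (F.map (𝟙 _)))
  have hw : F.map (homOfLE (B.inter_le_left B')) ≫ F.map (homOfLE (B.le_union_left B')) =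
      F.map (homOfLE (B.inter_le_right B')) ≫ F.map (homOfLE (B.le_union_right B')) := by
    rw [← F.map_comp, ← F.map_comp]
    rfl
  rcases B.eq_empty_or_eq_pt with rfl | rfl
  · have := hiso (Bdd.inter_le_left ∅ B') (Subtype.ext (Set.empty_inter B'.1))
    have := hiso (Bdd.le_union_right ∅ B') (Subtype.ext (Set.empty_union B'.1).symm)
    exact IsPushout.of_horiz_isIso ⟨hw⟩
  · have h : B'.1 ⊆ (Bdd.pt (default : X)).1 := fun x _ => Subsingleton.elim x default
    have := hiso (Bdd.inter_le_right (Bdd.pt default) B')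
      (Subtype.ext (Set.inter_eq_right.2 h))
    have := hiso (Bdd.le_union_left (Bdd.pt default) B')
      (Subtype.ext (Set.union_eq_left.2 h).symm)
    exact IsPushout.of_vert_isIso ⟨hw⟩

variable (k X) in
/-- The one-dimensional controlled vector space on the one-point space. -/
def pointObject : ControlledObject k X where
  M :=
    -- The free vector space on the points of `B`: zero on `∅`, a line on the point, functorial
    -- without case distinctions.
    { obj := fun B => FGModuleCat.of k (B.1 →₀ k)
      map := fun f => FGModuleCat.ofHom (Finsupp.lmapDomain k k (Set.inclusion (leOfHom f)))
      map_id := fun B => FGModuleCat.hom_ext (Finsupp.lmapDomain_id _ _)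
      map_comp := fun f g => FGModuleCat.hom_ext
        (Finsupp.lmapDomain_comp k k (Set.inclusion (leOfHom f)) (Set.inclusion (leOfHom g))) }
  isZero_empty := by
    have : Subsingleton ((∅ : Bdd X).1 →₀ k) :=
      have : IsEmpty (∅ : Bdd X).1 := inferInstanceAs (IsEmpty (∅ : Set X))
      inferInstance
    exact (IsZero.iff_id_eq_zero _).2 (FGModuleCat.hom_ext
      (LinearMap.ext fun x => Subsingleton.elim (α := (∅ : Bdd X).1 →₀ k) _ _))
  isPushout := Bdd.isPushout_map _
  finite_support B := ⟨B, le_rfl, Set.toFinite _, 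
    Functor.map_isIso _ (𝟙 B)⟩

variable (k X) in
/-- The value of the one-dimensional controlled vector space at the point. -/
def pointObjectEquiv : (pointObject k X).M.obj (Bdd.pt default) ≃ₗ[k] k :=
  Finsupp.uniqueLinearEquiv k k (⟨default, rfl⟩ : ({default} : Set X))

open ControlledObject

lemma finrank_pointObject :
    Module.finrank k ((pointObject k X).M.obj (Bdd.pt default)) = 1 :=
  (pointObjectEquiv k X).finrank_eq.trans (Module.finrank_self k)

/-- The controlled morphism on the one-point space with a given matrix entry. -/
def homOfEntry {M N : ControlledObject k X}
    (t : M.M.obj (Bdd.pt default) →ₗ[k] N.M.obj (Bdd.pt default)) : M ⟶ N :=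
  (entry_default_surjective M N (FGModuleCat.ofHom t)).choose

lemma entry_homOfEntry {M N : ControlledObject k X}
    (t : M.M.obj (Bdd.pt default) →ₗ[k] N.M.obj (Bdd.pt default)) :
    entry (default : X) default (homOfEntry t) = FGModuleCat.ofHom t :=
  (entry_default_surjective M N (FGModuleCat.ofHom t)).choose_spec

variable (k X) in
/-- Every controlled vector space on the one-point space is a finite sum of one-dimensional ones. -/
def pointGenerator : ScalarGenerator k (ControlledObject k X) where
  e := pointObject k X
  rank M := Module.finrank k (M.M.obj (Bdd.pt default))
  -- `inc M i` sends `1` to the `i`-th vector of a basis and `ret M i` is the `i`-th coordinate, so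
  -- the partition of the identity is the basis expansion of a vector.
  inc M i := homOfEntry ((pointObjectEquiv k X).toLinearMap.smulRight
    (Module.finBasis k (M.M.obj (Bdd.pt default)) i))
  ret M i := homOfEntry ((pointObjectEquiv k X).symm.toLinearMap ∘ₗ
    (Module.finBasis k (M.M.obj (Bdd.pt default))).coord i)
  sum_ret_inc M := by
    refine entry_default_injective M M ?_
    rw [map_sum, entry_id]
    simp only [entry_comp_default, entry_homOfEntry]
    refine FGModuleCat.hom_ext (LinearMap.ext fun x => ?_)
    have h := (Module.finBasis k (M.M.obj (Bdd.pt (default : X)))).sum_repr x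
    refine Eq.trans ?_ h
    let ev : (M.M.obj (Bdd.pt default) ⟶ M.M.obj (Bdd.pt default)) →+
        M.M.obj (Bdd.pt (default : X)) :=
      { toFun := fun g => g.hom.hom x, map_zero' := rfl, map_add' := fun _ _ => rfl }
    refine (map_sum ev _ _).trans (Finset.sum_congr rfl fun i _ => ?_)
    exact congrArg (fun c : k => c • Module.finBasis k (M.M.obj (Bdd.pt (default : X))) i)
      ((pointObjectEquiv k X).apply_symm_apply _)
  exists_smul_id g := by
    -- An endomorphism of a line is a scalar, and morphisms are determined by their entry.
    obtain ⟨c, hc, -⟩ := (entry (default : X) default g).hom.hom.existsUnique_eq_smul_id_of_finrank_eq_one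
      finrank_pointObject
    refine ⟨c, entry_default_injective _ _ ?_⟩
    rw [map_smul, entry_id]
    exact FGModuleCat.hom_ext hc

/-- The trace of an endomorphism of a controlled vector space on the one-point space. -/
def traceDefault (M : ControlledObject k X) : (M ⟶ M) →ₗ[k] k where
  toFun f := LinearMap.trace k (M.M.obj (Bdd.pt default)) (entry default default f).hom.hom
  map_add' f g := by
    rw [map_add]
    exact map_add (LinearMap.trace k _) (entry (default : X) default f).hom.hom
      (entry (default : X) default g).hom.hom
  map_smul' c f := by
    rw [map_smul]
    exact map_smul (LinearMap.trace k _) c (entry (default : X) default f).hom.hom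

lemma traceDefault_id_pointObject : traceDefault (pointGenerator k X).e (𝟙 _) = 1 := by
  change LinearMap.trace k ((pointObject k X).M.obj (Bdd.pt default))
    (entry (default : X) default (𝟙 (pointObject k X))).hom.hom = 1
  rw [entry_id]
  refine (LinearMap.trace_id k _).trans ?_
  rw [finrank_pointObject, Nat.cast_one]

lemma traceDefault_comm {M N : ControlledObject k X} (f : M ⟶ N) (g : N ⟶ M) :
    traceDefault M (f ≫ g) = traceDefault N (g ≫ f) := by
  change LinearMap.trace k _ (entry (default : X) default (f ≫ g)).hom.hom =
    LinearMap.trace k _ (entry (default : X) default (g ≫ f)).hom.hom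
  rw [entry_comp_default, entry_comp_default]
  exact trace_comm _ _

/-- The scalar by which an endomorphism of the line acts is its trace, as the identity of `e` has
trace one. -/
lemma eq_traceDefault_smul_id (g : (pointGenerator k X).e ⟶ (pointGenerator k X).e) :
    g = traceDefault _ g • 𝟙 _ := by
  obtain ⟨c, rfl⟩ := (pointGenerator k X).exists_smul_id g
  rw [map_smul, traceDefault_id_pointObject, smul_eq_mul, mul_one]

/-- The sum of the diagonal coefficients of an endomorphism is its trace. -/
lemma sum_inc_comp_ret {M : ControlledObject k X} (f : M ⟶ M) :
    ∑ i, (pointGenerator k X).inc M i ≫ f ≫ (pointGenerator k X).ret M i =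
      traceDefault M f • 𝟙 (pointGenerator k X).e := by
  -- Both sides are scalars on `e`, so it suffices to compare traces: cyclicity turns `inc i ≫ f ≫
  -- ret i` into `f ≫ ret i ≫ inc i`, and these sum to `f`.
  refine (eq_traceDefault_smul_id _).trans (congrArg (fun c => c • 𝟙 _) ?_)
  conv_rhs => rw [← Category.comp_id f, ← (pointGenerator k X).sum_ret_inc M, Preadditive.comp_sum]
  rw [map_sum, map_sum]
  refine Finset.sum_congr rfl fun i _ => ?_
  rw [← Category.assoc f, traceDefault_comm]

end OnePoint

/-! ### The trace augmentation and the comparison of the two complexes -/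

section Augmentation

open ControlledObject AlgebraicTopology

variable {k : Type u} [Field k] {X : Type u} [BornCoarse X] [Unique X] {m n : ℕ}

/-- With only one intermediate point the matrix product has a single summand, so taking entries
commutes with composites of any length. -/
lemma entry_down_default {N : Fin (n + 1) → ControlledObject k X} (f : CyclicString N)
    {i j : Fin (n + 1)} (h : i ≤ j) :
    entry (default : X) default (f.down h) = (entries f fun _ => default).down h := by
  induction j using Fin.induction with
  | zero =>
    obtain rfl : i = 0 := le_antisymm h (Fin.zero_le _)
    rw [CyclicString.down_self, CyclicString.down_self, entry_id]
  | succ j ih =>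
    rcases h.eq_or_lt with rfl | hlt
    · rw [CyclicString.down_self, CyclicString.down_self, entry_id]
    · have h' : i ≤ j.castSucc := Fin.le_castSucc_iff.2 hlt
      rw [CyclicString.down_succ _ h', CyclicString.down_succ _ h', entry_comp_default, ih h']
      rfl

lemma entries_pull_default {N : Fin (n + 1) → ControlledObject k X} (f : CyclicString N)
    (α : Fin (m + 1) →o Fin (n + 1)) :
    entries (f.pull α) (fun _ => (default : X)) = (entries f fun _ => default).pull α := by
  refine CyclicString.ext' ?_ fun j => entry_down_default f _
  refine Eq.trans ?_ (CyclicString.close_pull (entries f fun _ => default) α).symm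
  rw [← entry_down_default, ← entry_down_default]
  refine (congrArg _ (f.close_pull α)).trans ?_
  refine (entry_comp_default _ _).trans (congrArg (fun t => _ ≫ t) ?_)
  exact entry_comp_default f.close _

variable (k X) in
/-- The coefficient of a chain on the one-point space. -/
def coeffDefault (n : ℕ) : coarseChains k X n →ₗ[k] k :=
  LinearMap.proj (fun _ => default) ∘ₗ (coarseChains k X n).subtype

variable (k X) in
/-- On the one-point space, `φ_n` sends a cyclic string to the trace of its composite. -/
def cyclicNerveTrace (n : ℕ) : CyclicNerveModule k (ControlledObject k X) n →ₗ[k] k :=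
  coeffDefault k X n ∘ₗ phi k X n

lemma cyclicNerveTrace_tmul {N : Fin (n + 1) → ControlledObject k X} (f : CyclicString N) :
    cyclicNerveTrace k X n (CyclicNerveModule.tmul k N f) =
      cyclicTrace (entries f fun _ => (default : X)) := phi_tmul f _

/-- Regrouping a cyclic string does not change the trace of its composite. This covers all monotone
maps, degeneracies included, as naturality of the augmentation demands. -/
lemma cyclicNerveTrace_map (α : Fin (m + 1) →o Fin (n + 1)) :
    cyclicNerveTrace k X m ∘ₗ CyclicNerveModule.map α = cyclicNerveTrace k X n :=
  CyclicNerveModule.hom_ext fun N f => by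
    rw [LinearMap.comp_apply, CyclicNerveModule.map_tmul, cyclicNerveTrace_tmul,
      cyclicNerveTrace_tmul, entries_pull_default]
    exact cyclicTrace_pull _ α

lemma coeffDefault_injective : Function.Injective (coeffDefault k X n) := fun c d h =>
  Subtype.ext (funext fun x => by
    obtain rfl : x = fun _ => default := Subsingleton.elim _ _
    exact h)

/-- The fibre summed over is the whole one-element set `X ^ (n + 1)`. -/
lemma coeffDefault_push (α : Fin (m + 1) → Fin (n + 1)) (c : coarseChains k X n) :
    coeffDefault k X m (coarseChains.push α c) = coeffDefault k X n c := by
  have h : {y : Fin (n + 1) → X | y ∘ α = fun _ => default} = {fun _ => default} :=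
    Set.eq_singleton_iff_unique_mem.2 ⟨rfl, fun _ _ => Subsingleton.elim _ _⟩
  exact (finsum_mem_congr (f := c.1) h fun _ _ => rfl).trans finsum_mem_singleton

variable (k X) in
/-- The chain on the one-point space with a given coefficient. -/
def chainDefault (n : ℕ) : k →ₗ[k] coarseChains k X n :=
  LinearMap.codRestrict (coarseChains k X n) (LinearMap.pi fun _ => LinearMap.id) fun _ =>
    ⟨fun _ _ => Set.toFinite _, _, BornCoarse.diag, fun _ _ _ _ => Subsingleton.elim _ _⟩

variable (k X) in
/-- The augmented simplicial module of chains on the one-point space. -/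
def coarseChainsAugmented : SimplicialObject.Augmented (ModuleCat.{u + 1} k) where
  left := coarseChainsSimplicial k X
  right := ModuleCat.of k (ULift.{u + 1} k)
  hom :=
    { app := fun Δ => ModuleCat.ofHom (ULift.moduleEquiv.symm.toLinearMap ∘ₗ
        coeffDefault k X Δ.unop.len ∘ₗ ULift.moduleEquiv.toLinearMap)
      naturality := fun Δ Δ' α => by
        refine ModuleCat.hom_ext (LinearMap.ext fun c => congrArg ULift.up ?_)
        exact coeffDefault_push α.unop.toOrderHom c.down }

variable (k X) in
/-- The extra degeneracy of the chains on the one-point space. -/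
def coarseChainsExtraDegeneracy : (coarseChainsAugmented k X).ExtraDegeneracy :=
  -- A chain is its coefficient and every push preserves it, so each identity below follows by
  -- comparing coefficients.
  have hinj : ∀ {n : ℕ} {c d : ULift.{u + 1} (coarseChains k X n)},
      coeffDefault k X n c.down = coeffDefault k X n d.down → c = d := fun h =>
    ULift.ext _ _ (coeffDefault_injective h)
  { s' := ModuleCat.ofHom (ULift.moduleEquiv.symm.toLinearMap ∘ₗ chainDefault k X 0 ∘ₗ
      ULift.moduleEquiv.toLinearMap)
    -- Pushing along any map of indices would serve; the constant one is merely simplest.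
    s := fun n => ModuleCat.ofHom (ULift.moduleEquiv.symm.toLinearMap ∘ₗ
      coarseChains.push (fun _ => (0 : Fin (n + 1))) ∘ₗ ULift.moduleEquiv.toLinearMap)
    s'_comp_ε := rfl
    s₀_comp_δ₁ := ModuleCat.hom_ext (LinearMap.ext fun _ => hinj
      ((coeffDefault_push _ _).trans (coeffDefault_push _ _)))
    s_comp_δ₀ := fun _ => ModuleCat.hom_ext (LinearMap.ext fun _ => hinj
      ((coeffDefault_push _ _).trans (coeffDefault_push _ _)))
    s_comp_δ := fun _ _ => ModuleCat.hom_ext (LinearMap.ext fun _ => hinj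
      (((coeffDefault_push _ _).trans (coeffDefault_push _ _)).trans
        ((coeffDefault_push _ _).trans (coeffDefault_push _ _)).symm))
    s_comp_σ := fun _ _ => ModuleCat.hom_ext (LinearMap.ext fun _ => hinj
      (((coeffDefault_push _ _).trans (coeffDefault_push _ _)).trans
        ((coeffDefault_push _ _).trans (coeffDefault_push _ _)).symm)) }

lemma cyclicNerveTrace_scalarClass (c : k) :
    cyclicNerveTrace k X 0 ((pointGenerator k X).scalarClass c) = c := by
  rw [ScalarGenerator.scalarClass, LinearMap.toSpanSingleton_apply, map_smul]
  have h : cyclicNerveTrace k X 0 (CyclicNerveModule.tmulClose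
      (fun _ : Fin (0 + 1) => (pointGenerator k X).e) (fun i => i.elim0) (𝟙 _)) = 1 :=
    (cyclicNerveTrace_tmul _).trans ((cyclicTrace_fin_one _).trans traceDefault_id_pointObject)
  rw [h, smul_eq_mul, mul_one]

lemma sum_inc_comp_close_comp_ret (N : Fin (0 + 1) → ControlledObject k X) (f : CyclicString N) :
    ∑ i, (pointGenerator k X).inc (N 0) i ≫ f.close ≫ (pointGenerator k X).ret (N 0) i =
      cyclicNerveTrace k X 0 (CyclicNerveModule.tmul k N f) • 𝟙 (pointGenerator k X).e := by
  rw [cyclicNerveTrace_tmul, cyclicTrace_fin_one]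
  exact sum_inc_comp_ret (M := N 0) f.close

variable (k X) in
/-- The additive cyclic nerve of the category of controlled vector spaces on the one-point space,
augmented by the trace. -/
abbrev cyclicNerveTraceAugmented : SimplicialObject.Augmented (ModuleCat.{u + 1} k) :=
  cyclicNerveAugmented (cyclicNerveTrace k X) fun _ _ => cyclicNerveTrace_map

/-- Maps to a complex concentrated in degree zero are compared in that degree, where the trace
augmentation is by definition the coefficient of `phi`. -/
lemma phiChainMap_comp_augmentation :
    (phiChainMap k X : _ ⟶ (SimplicialObject.Augmented.drop ⋙ alternatingFaceMapComplex _).obj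
      (coarseChainsAugmented k X)) ≫
        AlternatingFaceMapComplex.ε.app (coarseChainsAugmented k X) =
      AlternatingFaceMapComplex.ε.app (cyclicNerveTraceAugmented k X) := by
  refine HomologicalComplex.to_single_hom_ext ?_
  refine (HomologicalComplex.comp_f _ _ 0).trans ?_
  refine (congrArg (fun t => _ ≫ t)
    (AlternatingFaceMapComplex.ε_app_f_zero (coarseChainsAugmented k X))).trans ?_
  refine Eq.trans ?_
    (AlternatingFaceMapComplex.ε_app_f_zero (cyclicNerveTraceAugmented k X)).symm
  rfl

lemma quasiIso_augmentation {C : Type*} [Category C] [Abelian C]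
    {A : SimplicialObject.Augmented C} (ed : A.ExtraDegeneracy) :
    QuasiIso (AlternatingFaceMapComplex.ε.app A) :=
  inferInstanceAs (QuasiIso ed.homotopyEquiv.hom)

lemma quasiIso_phiChainMap : QuasiIso (phiChainMap k X) := by
  have h1 := quasiIso_augmentation (coarseChainsExtraDegeneracy k X)
  have h2 := quasiIso_augmentation (cyclicNerveExtraDegeneracy (cyclicNerveTrace k X)
    (fun _ _ => cyclicNerveTrace_map) (pointGenerator k X) cyclicNerveTrace_scalarClass
    sum_inc_comp_close_comp_ret)
  -- Two out of three: the augmentation of the chains and its composite with `phiChainMap`, which is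
  -- the trace augmentation, are quasi-isomorphisms.
  exact quasiIso_of_comp_right
    (φ := (phiChainMap k X : _ ⟶ (SimplicialObject.Augmented.drop ⋙
      alternatingFaceMapComplex _).obj (coarseChainsAugmented k X)))
    (φ' := AlternatingFaceMapComplex.ε.app (coarseChainsAugmented k X))
    (hφ := h1) (hφφ' := phiChainMap_comp_augmentation (k := k) (X := X) ▸ h2)

end Augmentation

end CoarseHH

end

theorem proposition4p8 (k : Type u) [Field k] (X : Type u) [CoarseHH.BornCoarse X] [Unique X] :
    QuasiIso (CoarseHH.phiChainMap k X) :=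
  CoarseHH.quasiIso_phiChainMap
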